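/- **Setting.** Let $\mathbb W$ be a probability law on a space $\mathcal W$, let $c$ be a fixed integer, and let $h(\cdot,\cdot;\kappa_a)$, $1\le a\le c$, be symmetric measurable functions on $\mathcal W\times\mathcal W$. For each $n$ let $W=\{w_1,\dots,w_n\}$ be i.i.d. from $\mathbb W$, and put $$U_n^{\kappa_a}(W)=\binom n2^{-1}\sum_{1\le i<j\le n}h(w_i,w_j;\kappa_a),\qquad \boldsymbol U_n^{\mathcal K}(W)=(U_n^{\kappa_1}(W),\dots,U_n^{\kappa_c}(W))^T .$$ Let $h_1(w;\kappa_a)=E[h(w,w_2;\kappa_a)]$ with $w_2\sim\mathbb W$, and $U^{\kappa_a}(\mathbb W)=E[h(w_1,w_2;\kappa_a)]$, $\boldsymbol U^{\mathcal K}(\mathbb W)=(U^{\kappa_a}(\mathbb W))_{a}$. **Part 1.** Suppose that, for every $a$, $h(\cdot;\kappa_a)$ is non-degenerate under the alternative law $\mathbb W$, i.e. $\operatorname{Var}(h_1(w_1;\kappa_a))\ne0$, and $E[h^2(w_1,w_2;\kappa_a)]<\infty$. Then $E[\boldsymbol U_n^{\mathcal K}(W)]=\boldsymbol U^{\mathcal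 K}(\mathbb W)$ for $n\ge2$, and $$\sqrt n\,\bigl(\boldsymbol U_n^{\mathcal K}(W)-\boldsymbol U^{\mathcal K}(\mathbb W)\bigr)\xrightarrow{d}\mathcal N(\boldsymbol 0,\Sigma_{H_1}),$$ where $\Sigma_{H_1}$ is the (positive semidefinite) limit of the covariance matrices of $\sqrt n\,\boldsymbol U_n^{\mathcal K}(W)$ and has the entries $$\sigma_{H_1,a,b}=4\bigl(E[h_1(w_1;\kappa_a)h_1(w_1;\kappa_b)]-U^{\kappa_a}(\mathbb W)\,U^{\kappa_b}(\mathbb W)\bigr).$$ **Part 2.** Let, in addition, a null sample $W_{H_0}=\{w'_1,\dots,w'_n\}$ be simulated by resampling $W$ with replacement: $w'_i=\rho(w_{J_{i,1}},\dots,w_{J_{i,k}},e_i)$, where $\rho$ is a fixed measurable map, the indices $J_{i,s}$ are i.i.d. uniform on $\{1,\dots,n\}$, the $e_i$ are i.i.d. auxiliary variables, and $(J_{i,s})$, $(e_i)$ and $W$ are independent. (For $k=0$ the $w'_i$ are i.i.d. draws from a given null law, independent of $W$.) Let $\mathbb W_0$ be the law of $\rho(w_1,\dots,w_k,e_1)$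 for i.i.d. $w_1,\dots,w_k\sim\mathbb W$. Suppose that every $h(\cdot;\kappa_a)$ is first-order degenerate under $\mathbb W_0$, i.e. $E[h(w,w'_2;\kappa_a)]=0$ with $w'_2\sim\mathbb W_0$, for $\mathbb W_0$-almost every $w$; that for all $I,J\in\{1,\dots,2k\}^k$ $$E\Bigl[h\bigl(\rho(w_{I_1},\dots,w_{I_k},e_1),\rho(w_{J_1},\dots,w_{J_k},e_2);\kappa_a\bigr)^2\Bigr]<\infty$$ for i.i.d. $w_1,\dots,w_{2k}\sim\mathbb W$ independent of $e_1,e_2$ (automatic for bounded $h$); and that the matrix $$\Sigma_{H_0}=\Bigl(2\,E\bigl[h(v_1,v_2;\kappa_a)\,h(v_1,v_2;\kappa_b)\bigr]\Bigr)_{a,b},\qquad v_1,v_2\overset{iid}{\sim}\mathbb W_0,$$ which is the limit of the covariance matrices of $n\,\boldsymbol U_n^{\mathcal K}$ for i.i.d. samples of size $n$ from $\mathbb W_0$, is positive definite. Let $\widehat\Sigma_{H_0}$ be the matrix with entries $$n^2\binom n2^{-2}\sum_{1\le i<j\le n}h(w'_i,w'_j;\kappa_a)\,h(w'_i,w'_j;\kappa_b),$$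 and $T_n^{\mathcal K}(W)=n^2\,\boldsymbol U_n^{\mathcal K}(W)^T\,\widehat\Sigma_{H_0}^{-1}\,\boldsymbol U_n^{\mathcal K}(W)$ (with $\widehat\Sigma_{H_0}^{-1}:=0$ where $\widehat\Sigma_{H_0}$ is singular). Then $$n^{-3/2}\Bigl(T_n^{\mathcal K}(W)-n^2\,\boldsymbol U^{\mathcal K}(\mathbb W)^T\,\widehat\Sigma_{H_0}^{-1}\,\boldsymbol U^{\mathcal K}(\mathbb W)\Bigr)\xrightarrow{d}\mathcal N(0,\sigma^2_{H_1}),\qquad \sigma^2_{H_1}=4\,\boldsymbol U^{\mathcal K}(\mathbb W)^T\,\Sigma_{H_0}^{-1}\,\Sigma_{H_1}\,\Sigma_{H_0}^{-1}\,\boldsymbol U^{\mathcal K}(\mathbb W).$$ -/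

import Mathlib

open MeasureTheory ProbabilityTheory Filter Topology Matrix

universe u v w

noncomputable section

namespace UAgg

/-- The second-order `U`-statistic `(n choose 2)⁻¹ ∑_{i < j} g (w i) (w j)` of a sample of
size `n`. -/
def uStat {S : Type*} {n : ℕ} (g : S → S → ℝ) (w : Fin n → S) : ℝ :=
  ((n.choose 2 : ℕ) : ℝ)⁻¹ * ∑ i : Fin n, ∑ j ∈ Finset.Ioi i, g (w i) (w j)

/-- The multivariate `U`-statistic, one coordinate for each kernel. -/
def uVec {S : Type*} {c n : ℕ} (h : Fin c → S → S → ℝ) (w : Fin n → S) : Fin c → ℝ :=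
  fun a => uStat (h a) w

/-- The first-order projection `h₁(x) = E[h(x, w)]`, `w ∼ P`. -/
def proj {S : Type*} [MeasurableSpace S] (P : Measure S) (g : S → S → ℝ) (x : S) : ℝ :=
  ∫ y, g x y ∂P

/-- The population value `E[h(w₁, w₂)]` for independent `w₁, w₂ ∼ P`, one coordinate for each
kernel. -/
def uPop {S : Type*} [MeasurableSpace S] {c : ℕ} (P : Measure S) (h : Fin c → S → S → ℝ) :
    Fin c → ℝ :=
  fun a => ∫ p, h a p.1 p.2 ∂(P.prod P)

/-- The matrix with entries `4 (E[h₁(w; a) h₁(w; b)] - U(a) U(b))`. -/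
def sigmaAlt {S : Type*} [MeasurableSpace S] {c : ℕ} (P : Measure S)
    (h : Fin c → S → S → ℝ) : Matrix (Fin c) (Fin c) ℝ :=
  Matrix.of fun a b =>
    4 * ((∫ x, proj P (h a) x * proj P (h b) x ∂P) - uPop P h a * uPop P h b)

/-- The matrix with entries `2 E[h(w₁, w₂; a) h(w₁, w₂; b)]` for independent `w₁, w₂ ∼ P₀`. If
the `h(·, ·; a)` are degenerate under `P₀`, this is the limit of the covariance matrix of
`n • uVec h` for samples of size `n` from `P₀`. -/
def sigmaNull {S : Type*} [MeasurableSpace S] {c : ℕ} (P₀ : Measure S)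
    (h : Fin c → S → S → ℝ) : Matrix (Fin c) (Fin c) ℝ :=
  Matrix.of fun a b => 2 * ∫ p, h a p.1 p.2 * h b p.1 p.2 ∂(P₀.prod P₀)

/-- The second-order covariance estimator, computed from a (null) sample `v` of size `n`:
entries `n² (n choose 2)⁻² ∑_{i < j} h(v i, v j; a) h(v i, v j; b)`. -/
def sigmaHat {S : Type*} {c n : ℕ} (h : Fin c → S → S → ℝ) (v : Fin n → S) :
    Matrix (Fin c) (Fin c) ℝ :=
  Matrix.of fun a b => (n : ℝ) ^ 2 * (((n.choose 2 : ℕ) : ℝ) ^ 2)⁻¹ *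
    ∑ i : Fin n, ∑ j ∈ Finset.Ioi i, h a (v i) (v j) * h b (v i) (v j)

/-- The aggregated statistic `n² Uᵀ Σ̂⁻¹ U`, with `U` computed from `w` and `Σ̂` from the null
sample `v`. -/
def aggStat {S : Type*} {c n : ℕ} (h : Fin c → S → S → ℝ) (w v : Fin n → S) : ℝ :=
  (n : ℝ) ^ 2 * (uVec h w ⬝ᵥ ((sigmaHat h v)⁻¹ *ᵥ uVec h w))

/-- The random element `x` of size-`n` arrays is an i.i.d. sample with law `P`. -/
structure IsSample {Ω S : Type*} [MeasurableSpace Ω] [MeasurableSpace S] (μ : Measure Ω)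
    (P : Measure S) {n : ℕ} (x : Fin n → Ω → S) : Prop where
  indep : iIndepFun x μ
  law : ∀ i, HasLaw (x i) P μ

/-- One simulated null observation is `ρ (w_{J 1}, …, w_{J k}) e`: a fixed map `ρ` applied to `k`
observations drawn with replacement from the data `w` and to auxiliary randomness `e`. `nullLaw`
is the law of such an observation when the `k` drawn data points are independent.

Two-sample case, `w = (x, y)`: `k = 2`, `e` consists of two fair coins, and
`ρ (w₁, w₂) e = (x', y')` where `x'` (resp. `y'`) is one of the two components of `w₁` (resp. `w₂`),
chosen by a coin; so `x'` and `y'` are drawn with replacement from the pooled data.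
Independence case: `k = 4`, and the two `x`-entries and the two `y`-entries of the new quadruple
are drawn separately. For `k = 0` the null observations are external draws with law `nullLaw`. -/
def nullLaw {S A : Type*} [MeasurableSpace S] [MeasurableSpace A] {k : ℕ} (P : Measure S)
    (Q : Measure A) (ρ : (Fin k → S) → A → S) : Measure S :=
  ((Measure.pi fun _ : Fin k => P).prod Q).map fun p => ρ p.1 p.2

/-- The simulated null sample of size `n` computed from the data `w`: the `i`-th observation uses
the drawn indices `(r i).1` and the auxiliary randomness `(r i).2`. -/
def nullSample {S A : Type*} {k n : ℕ} (ρ : (Fin k → S) → A → S) (w : Fin n → S)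
    (r : Fin n → (Fin k → Fin n) × A) : Fin n → S :=
  fun i => ρ (fun s => w ((r i).1 s)) (r i).2

/-- `r` is the resampling randomness for the data `w`: over the `n` simulated observations it is
i.i.d., each time with `k` indices uniform on the `n` data points (drawing with replacement) and an
independent auxiliary variable of law `Q`; and it is independent of the data. -/
structure IsResampling {Ω S A : Type*} [MeasurableSpace Ω] [MeasurableSpace S]
    [MeasurableSpace A] {k n : ℕ} (μ : Measure Ω) (Q : Measure A) (w : Fin n → Ω → S)
    (r : Fin n → Ω → (Fin k → Fin n) × A) : Prop where
  sample : IsSample μ ((uniformOn (Set.univ : Set (Fin k → Fin n))).prod Q) r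
  indep_data : IndepFun (fun ω i => w i ω) (fun ω i => r i ω) μ

/-- Finite second moments of `g` at two simulated null observations, whichever coincidences the
drawing with replacement produces among the (at most `2k`) data points entering them. It holds for
every bounded measurable `g`; for `k = 0` it says that `E[g(v₁, v₂)²] < ∞` for independent
`v₁, v₂ ∼ nullLaw`. -/
def NullSquareIntegrable {S A : Type*} [MeasurableSpace S] [MeasurableSpace A] {k : ℕ}
    (P : Measure S) (Q : Measure A) (ρ : (Fin k → S) → A → S) (g : S → S → ℝ) : Prop :=
  ∀ I J : Fin k → Fin (2 * k),
    MemLp (fun p : (Fin (2 * k) → S) × A × A =>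
        g (ρ (fun s => p.1 (I s)) p.2.1) (ρ (fun s => p.1 (J s)) p.2.2)) 2
      ((Measure.pi fun _ : Fin (2 * k) => P).prod (Q.prod Q))

end UAgg

end

/-! Part 1 is Hoeffding's argument. Splitting a kernel into its mean, its centred projections and a
degenerate rest writes `U_n - U` as an i.i.d. average of the influence functions `2 (h₁ - U)` plus a
`U`-statistic of a degenerate kernel (`uStat_sub_eq`). A degenerate kernel is orthogonal to whatever
ignores one of its points (`integral_mul_eq_zero_of_degenerate`), so the second summand has second
moment of order `n⁻²` and disappears after scaling by `√n`. The average obeys the multivariate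
central limit theorem, proved with characteristic functions. The same orthogonality gives the exact
covariances.

Part 2 rests on the identity `xᵀBx - uᵀBu = (x - u)ᵀB(x + u)` for symmetric `B`. With `B = Σ̂⁻¹` it
turns the normalised statistic into the inner product of `√n (U_n - U)` and `Σ̂⁻¹ (U_n + U)`
(`aggStat_sub_eq`). The second factor tends in measure to the constant `2 Σ₀⁻¹ U`, so Slutsky's
theorem applies; no independence of `U_n` and `Σ̂` is needed.

The remaining difficulty is the consistency of `Σ̂`, since simulated observations share data points
and are dependent. Given the drawn indices, the law of `m` of them depends only on the coincidences
among the indices (`patternLaw`). Without coincidences they are i.i.d. with law `nullLaw`, and for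
fixed `m` coincidences have probability tending to `0`. Hence a bounded centred kernel has a
`U`-statistic with small second moment (`integral_sq_uStat_resample_le`). A general kernel is
truncated. The error is bounded uniformly in `n`, because two observations always follow one of the
finitely many patterns on `2k` points (`exists_patternLaw_eq`), where integrability is assumed. -/

noncomputable section

namespace UAgg

open scoped ENNReal

/-! ### I.i.d. samples as product measures, and orthogonality of degenerate kernels. -/

section ProductMeasure

variable {ι S : Type*} [Fintype ι] [MeasurableSpace S] (P : Measure S) [IsProbabilityMeasure P]

/-- Replacing one coordinate of an i.i.d. sample by an independent copy does not change the law. -/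
lemma measurePreserving_update [DecidableEq ι] (j : ι) :
    MeasurePreserving (fun p : (ι → S) × S => Function.update p.1 j p.2)
      ((Measure.pi fun _ : ι => P).prod P) (Measure.pi fun _ : ι => P) := by
  have hm : Measurable (fun p : (ι → S) × S => Function.update p.1 j p.2) := by
    refine measurable_pi_lambda _ fun i => ?_
    by_cases hi : i = j
    · subst hi; simpa using measurable_snd
    · simp only [Function.update_of_ne hi]; fun_prop
  refine ⟨hm, (Measure.pi_eq fun s hs => ?_).symm⟩
  rw [Measure.map_apply hm (MeasurableSet.univ_pi hs)]
  have : (fun p : (ι → S) × S => Function.update p.1 j p.2) ⁻¹' Set.univ.pi s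
      = (Set.univ.pi (Function.update s j Set.univ)) ×ˢ s j := by
    ext ⟨v, y⟩
    simp only [Set.mem_preimage, Set.mem_pi, Set.mem_univ, forall_true_left, Set.mem_prod]
    constructor
    · intro h
      refine ⟨fun i => ?_, by simpa using h j⟩
      by_cases hi : i = j
      · subst hi; simp
      · simpa [hi] using h i
    · rintro ⟨h1, h2⟩ i
      by_cases hi : i = j
      · subst hi; simpa using h2
      · simpa [hi] using h1 i
  -- The old coordinate `j` is unconstrained and contributes the factor `1`; the fresh value
  -- supplies the missing `P (s j)`.
  rw [this, Measure.prod_prod, Measure.pi_pi,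
    ← Finset.mul_prod_erase Finset.univ (fun i => P (s i)) (Finset.mem_univ j),
    ← Finset.mul_prod_erase Finset.univ _ (Finset.mem_univ j), mul_comm]
  simp only [Function.update_self, measure_univ, one_mul]
  congr 1
  exact Finset.prod_congr rfl fun i hi => by rw [Function.update_of_ne (Finset.ne_of_mem_erase hi)]

/-- A subfamily of an i.i.d. family is i.i.d. -/
lemma measurePreserving_precomp {κ : Type*} [Fintype κ] {f : κ → ι} (hf : f.Injective) :
    MeasurePreserving (fun (v : ι → S) i => v (f i)) (Measure.pi fun _ : ι => P)
      (Measure.pi fun _ : κ => P) := by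
  refine ⟨by fun_prop, ?_⟩
  have h0 : iIndepFun (fun (i : ι) (v : ι → S) => v i) (Measure.pi fun _ : ι => P) :=
    (iIndepFun_pi (μ := fun _ : ι => P) (X := fun _ x => x) (by fun_prop))
  have h1 := h0.precomp hf
  exact (h1.hasLaw_pi (μ := fun _ => P) fun i =>
    (measurePreserving_eval (fun _ : ι => P) (f i)).hasLaw).map_eq

lemma measurePreserving_eval_pair {i j : ι} (hij : i ≠ j) :
    MeasurePreserving (fun v : ι → S => (v i, v j)) (Measure.pi fun _ : ι => P) (P.prod P) := by
  have h0 : iIndepFun (fun (i : ι) (v : ι → S) => v i) (Measure.pi fun _ : ι => P) :=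
    (iIndepFun_pi (μ := fun _ : ι => P) (X := fun _ x => x) (by fun_prop))
  have h1 := h0.indepFun hij
  exact ⟨by fun_prop, ((indepFun_iff_hasLaw_prodMk_prod
    (measurePreserving_eval (fun _ : ι => P) i).hasLaw
    (measurePreserving_eval (fun _ : ι => P) j).hasLaw).1 h1).map_eq⟩

variable {P}

lemma ae_proj_eval {g : S → S → ℝ} (hg : proj P g =ᵐ[P] 0) (i : ι) :
    ∀ᵐ v ∂(Measure.pi fun _ : ι => P), proj P g (v i) = 0 :=
  (measurePreserving_eval (fun _ : ι => P) i).quasiMeasurePreserving.ae hg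

/-- A degenerate kernel is orthogonal to everything that does not depend on its second point. -/
lemma integral_mul_eq_zero_of_degenerate [DecidableEq ι] {g : S → S → ℝ}
    (hg : proj P g =ᵐ[P] 0) {i j : ι} (hij : i ≠ j)
    {F : (ι → S) → ℝ} (hF : ∀ v y, F (Function.update v j y) = F v)
    (hint : Integrable (fun v => g (v i) (v j) * F v) (Measure.pi fun _ : ι => P)) :
    ∫ v, g (v i) (v j) * F v ∂(Measure.pi fun _ : ι => P) = 0 := by
  -- Coordinate `j` is redrawn independently. Integrating over the fresh value first leaves `proj P
  -- g (v i)` times the unchanged `F v`.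
  have hmp := measurePreserving_update P j
  have hint' := hmp.integrable_comp_of_integrable hint
  rw [Function.comp_def] at hint'
  rw [← hmp.map_eq, integral_map hmp.measurable.aemeasurable
    (by rw [hmp.map_eq]; exact hint.aestronglyMeasurable), integral_prod _ hint']
  rw [integral_eq_zero_of_ae]
  filter_upwards [ae_proj_eval (ι := ι) hg i] with v hv
  simp only [hF, Function.update_self, Function.update_of_ne hij, Pi.zero_apply]
  rw [integral_mul_const]
  have : ∫ y, g (v i) y ∂P = 0 := hv
  rw [this, zero_mul]

end ProductMeasure

/-! ### Sums over pairs of indices. -/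

section Pairs

/-- The pairs `i < j` of indices. -/
def pairs (n : ℕ) : Finset (Fin n × Fin n) := Finset.univ.filter fun p => p.1 < p.2

lemma mem_pairs {n : ℕ} {p : Fin n × Fin n} : p ∈ pairs n ↔ p.1 < p.2 := by simp [pairs]

lemma sum_Ioi_eq_sum_pairs {n : ℕ} (F : Fin n → Fin n → ℝ) :
    ∑ i : Fin n, ∑ j ∈ Finset.Ioi i, F i j = ∑ p ∈ pairs n, F p.1 p.2 := by
  rw [pairs, Finset.sum_filter, Fintype.sum_prod_type]
  refine Finset.sum_congr rfl fun i _ => ?_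
  rw [← Finset.sum_filter]
  exact Finset.sum_congr (by ext; simp) fun _ _ => rfl

lemma card_pairs (n : ℕ) : (pairs n).card = n.choose 2 := by
  have h : ∑ i : Fin n, ∑ j ∈ Finset.Ioi i, (1 : ℕ) = (pairs n).card := by
    rw [pairs, Finset.card_filter, Fintype.sum_prod_type]
    refine Finset.sum_congr rfl fun i _ => ?_
    rw [← Finset.sum_filter]
    exact Finset.sum_congr (by ext; simp) fun _ _ => rfl
  rw [← h]
  simp only [Finset.sum_const, Fin.card_Ioi, smul_eq_mul, mul_one]
  rw [Fin.sum_univ_eq_sum_range (fun i => n - 1 - i), Finset.sum_range_reflect (fun i => i),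
    Finset.sum_range_id, Nat.choose_two_right]

lemma uStat_eq_sum_pairs {S : Type*} {n : ℕ} (g : S → S → ℝ) (v : Fin n → S) :
    uStat g v = ((n.choose 2 : ℕ) : ℝ)⁻¹ * ∑ p ∈ pairs n, g (v p.1) (v p.2) := by
  rw [uStat, sum_Ioi_eq_sum_pairs fun i j => g (v i) (v j)]

lemma choose_two_pos {n : ℕ} (hn : 2 ≤ n) : (0 : ℝ) < ((n.choose 2 : ℕ) : ℝ) := by
  exact_mod_cast Nat.choose_pos hn

lemma cast_choose_two (n : ℕ) : ((n.choose 2 : ℕ) : ℝ) = n * (n - 1) / 2 := Nat.cast_choose_two ℝ n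

lemma measurable_uStat {S : Type*} [MeasurableSpace S] {n : ℕ} {g : S → S → ℝ}
    (hg : Measurable (Function.uncurry g)) : Measurable (fun v : Fin n → S => uStat g v) := by
  simp_rw [uStat_eq_sum_pairs]
  refine (Finset.measurable_sum _ fun p _ => ?_).const_mul _
  exact hg.comp (f := fun v : Fin n → S => (v p.1, v p.2)) (by fun_prop)

end Pairs

/-! ### Means and covariances of `U`-statistics of degenerate kernels. -/

section Moments

variable {S : Type*} [MeasurableSpace S] {P : Measure S} [IsProbabilityMeasure P] {n : ℕ}

lemma memLp_eval_pair {g : S → S → ℝ} {q : ℝ≥0∞}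
    (hg : MemLp (fun p : S × S => g p.1 p.2) q (P.prod P)) {i j : Fin n} (hij : i ≠ j) :
    MemLp (fun v : Fin n → S => g (v i) (v j)) q (Measure.pi fun _ : Fin n => P) :=
  hg.comp_measurePreserving (measurePreserving_eval_pair P hij)

lemma memLp_uStat {g : S → S → ℝ} {q : ℝ≥0∞}
    (hg : MemLp (fun p : S × S => g p.1 p.2) q (P.prod P)) :
    MemLp (fun v : Fin n → S => uStat g v) q (Measure.pi fun _ : Fin n => P) := by
  simp_rw [uStat_eq_sum_pairs]
  have h : MemLp (fun v : Fin n → S => ∑ p ∈ pairs n, g (v p.1) (v p.2)) q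
      (Measure.pi fun _ : Fin n => P) :=
    memLp_finsetSum _ fun p hp => memLp_eval_pair hg (mem_pairs.1 hp).ne
  exact h.const_mul _

lemma integral_eval_pair {g : S → S → ℝ}
    (hg : AEStronglyMeasurable (fun p : S × S => g p.1 p.2) (P.prod P)) {i j : Fin n}
    (hij : i ≠ j) :
    ∫ v, g (v i) (v j) ∂(Measure.pi fun _ : Fin n => P) = ∫ p, g p.1 p.2 ∂(P.prod P) :=
  (measurePreserving_eval_pair P hij).hasLaw.integral_comp hg

lemma integral_uStat {g : S → S → ℝ} (hg : Integrable (fun p : S × S => g p.1 p.2) (P.prod P))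
    (hn : 2 ≤ n) :
    ∫ v, uStat g v ∂(Measure.pi fun _ : Fin n => P) = ∫ p, g p.1 p.2 ∂(P.prod P) := by
  simp_rw [uStat_eq_sum_pairs]
  rw [integral_const_mul, integral_finsetSum]
  · rw [Finset.sum_congr rfl fun p hp => integral_eval_pair hg.1 (mem_pairs.1 hp).ne]
    rw [Finset.sum_const, card_pairs, nsmul_eq_mul, inv_mul_cancel_left₀ (choose_two_pos hn).ne']
  · intro p hp
    exact memLp_one_iff_integrable.1
      (memLp_eval_pair (memLp_one_iff_integrable.2 hg) (mem_pairs.1 hp).ne)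

lemma integral_eq_zero_of_degenerate {g : S → S → ℝ}
    (hg : Integrable (fun p : S × S => g p.1 p.2) (P.prod P)) (hd : proj P g =ᵐ[P] 0) :
    ∫ p, g p.1 p.2 ∂(P.prod P) = 0 := by
  rw [integral_prod _ hg]
  exact integral_eq_zero_of_ae hd

/-- Degenerate symmetric kernels evaluated at different pairs of points are uncorrelated. -/
lemma integral_pair_mul_pair_of_degenerate {f g : S → S → ℝ}
    (hf : MemLp (fun p : S × S => f p.1 p.2) 2 (P.prod P))
    (hg : MemLp (fun p : S × S => g p.1 p.2) 2 (P.prod P))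
    (hfs : ∀ x y, f x y = f y x) (hfd : proj P f =ᵐ[P] 0)
    {p q : Fin n × Fin n} (hp : p ∈ pairs n) (hq : q ∈ pairs n) (hpq : p ≠ q) :
    ∫ v, f (v p.1) (v p.2) * g (v q.1) (v q.2) ∂(Measure.pi fun _ : Fin n => P) = 0 := by
  have hp' := mem_pairs.1 hp
  have hq' := mem_pairs.1 hq
  have hint := (memLp_eval_pair hf hp'.ne).integrable_mul (memLp_eval_pair hg hq'.ne)
  -- Distinct increasing pairs leave some point of `p` outside `q`. If `p.2` lies in `q`, the
  -- ordering and `p ≠ q` force `p.1` outside `q`, and symmetry of `f` moves that point to the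
  -- second slot, where degeneracy acts.
  by_cases h2 : p.2 ≠ q.1 ∧ p.2 ≠ q.2
  · refine integral_mul_eq_zero_of_degenerate hfd hp'.ne (fun v y => ?_) hint
    rw [Function.update_of_ne h2.1.symm, Function.update_of_ne h2.2.symm]
  · have h1 : p.1 ≠ q.1 ∧ p.1 ≠ q.2 := by
      rcases p with ⟨a, b⟩
      rcases q with ⟨c, d⟩
      simp only [ne_eq, Prod.mk.injEq, not_and, Classical.not_not] at *
      omega
    have hfs' : ∀ v : Fin n → S, f (v p.1) (v p.2) = f (v p.2) (v p.1) := fun v => hfs _ _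
    simp only [hfs']
    refine integral_mul_eq_zero_of_degenerate hfd hp'.ne' (fun v y => ?_) ?_
    · rw [Function.update_of_ne h1.1.symm, Function.update_of_ne h1.2.symm]
    · simpa only [← hfs', Pi.mul_def] using hint

lemma integral_uStat_mul_uStat {f g : S → S → ℝ}
    (hf : MemLp (fun p : S × S => f p.1 p.2) 2 (P.prod P))
    (hg : MemLp (fun p : S × S => g p.1 p.2) 2 (P.prod P))
    (hfs : ∀ x y, f x y = f y x) (hfd : proj P f =ᵐ[P] 0) :
    ∫ v, uStat f v * uStat g v ∂(Measure.pi fun _ : Fin n => P) =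
      ((n.choose 2 : ℕ) : ℝ)⁻¹ * ∫ p, f p.1 p.2 * g p.1 p.2 ∂(P.prod P) := by
  set N : ℝ := ((n.choose 2 : ℕ) : ℝ) with hN
  have hint : ∀ p ∈ pairs n, ∀ q ∈ pairs n,
      Integrable (fun v : Fin n → S => f (v p.1) (v p.2) * g (v q.1) (v q.2))
        (Measure.pi fun _ : Fin n => P) := fun p hp q hq =>
    (memLp_eval_pair hf (mem_pairs.1 hp).ne).integrable_mul
      (memLp_eval_pair hg (mem_pairs.1 hq).ne)
  have hexp : ∀ v : Fin n → S, uStat f v * uStat g v =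
      (N⁻¹ * N⁻¹) * ∑ p ∈ pairs n, ∑ q ∈ pairs n, f (v p.1) (v p.2) * g (v q.1) (v q.2) := by
    intro v
    rw [uStat_eq_sum_pairs, uStat_eq_sum_pairs, ← Finset.sum_mul_sum]
    ring
  simp_rw [hexp]
  rw [integral_const_mul, integral_finsetSum _ fun p hp => integrable_finsetSum _ (hint p hp)]
  have hin : ∀ p ∈ pairs n, ∫ v, ∑ q ∈ pairs n, f (v p.1) (v p.2) * g (v q.1) (v q.2)
      ∂(Measure.pi fun _ : Fin n => P) = ∫ p, f p.1 p.2 * g p.1 p.2 ∂(P.prod P) := by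
    intro p hp
    rw [integral_finsetSum _ (hint p hp), Finset.sum_eq_single p]
    · exact integral_eval_pair (g := fun x y => f x y * g x y) (hf.integrable_mul hg).1
        (mem_pairs.1 hp).ne
    · intro q hq hqp
      exact integral_pair_mul_pair_of_degenerate hf hg hfs hfd hp hq hqp.symm
    · exact fun h => absurd hp h
  rw [Finset.sum_congr rfl hin, Finset.sum_const, card_pairs, nsmul_eq_mul, ← hN]
  -- For `n < 2` there are no pairs, and both sides vanish because the inverse of `0` is `0`.
  by_cases h0 : N = 0
  · simp [h0]
  · field_simp

lemma cov_uStat_of_degenerate {f g : S → S → ℝ}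
    (hf : MemLp (fun p : S × S => f p.1 p.2) 2 (P.prod P))
    (hg : MemLp (fun p : S × S => g p.1 p.2) 2 (P.prod P))
    (hfs : ∀ x y, f x y = f y x) (hfd : proj P f =ᵐ[P] 0) :
    cov[fun v => uStat f v, fun v => uStat g v; Measure.pi fun _ : Fin n => P] =
      ((n.choose 2 : ℕ) : ℝ)⁻¹ * ∫ p, f p.1 p.2 * g p.1 p.2 ∂(P.prod P) := by
  rw [covariance_eq_sub (memLp_uStat hf) (memLp_uStat hg)]
  have h0 : ∫ v, uStat f v ∂(Measure.pi fun _ : Fin n => P) = 0 := by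
    by_cases hn : 2 ≤ n
    · rw [integral_uStat (hf.integrable one_le_two) hn,
        integral_eq_zero_of_degenerate (hf.integrable one_le_two) hfd]
    · have : n.choose 2 = 0 := Nat.choose_eq_zero_of_lt (by omega)
      simp [uStat, this]
  rw [h0, zero_mul, sub_zero]
  exact integral_uStat_mul_uStat hf hg hfs hfd

lemma tendsto_sq_mul_inv_choose_two :
    Tendsto (fun n : ℕ => (n : ℝ) ^ 2 * ((n.choose 2 : ℕ) : ℝ)⁻¹) atTop (𝓝 2) := by
  have h : Tendsto (fun n : ℕ => 2 * (1 + ((n : ℝ) - 1)⁻¹)) atTop (𝓝 (2 * (1 + 0))) := by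
    refine (tendsto_const_nhds.add ?_).const_mul 2
    exact tendsto_inv_atTop_zero.comp
      (tendsto_atTop_add_const_right _ (-1) tendsto_natCast_atTop_atTop)
  rw [add_zero, mul_one] at h
  refine h.congr' ?_
  filter_upwards [eventually_ge_atTop 2] with n hn
  have hn' : (2 : ℝ) ≤ n := by exact_mod_cast hn
  have : (n : ℝ) - 1 ≠ 0 := by linarith
  have : (n : ℝ) ≠ 0 := by linarith
  rw [cast_choose_two]
  field_simp
  ring

lemma tendsto_mul_inv_choose_two :
    Tendsto (fun n : ℕ => (n : ℝ) * ((n.choose 2 : ℕ) : ℝ)⁻¹) atTop (𝓝 0) := by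
  have h := tendsto_sq_mul_inv_choose_two.mul (tendsto_inv_atTop_nhds_zero_nat (𝕜 := ℝ))
  rw [mul_zero] at h
  refine h.congr fun n => ?_
  rcases eq_or_ne (n : ℝ) 0 with h0 | h0
  · simp [h0]
  · field_simp

lemma tendsto_cov_uStat_of_degenerate {f g : S → S → ℝ}
    (hf : MemLp (fun p : S × S => f p.1 p.2) 2 (P.prod P))
    (hg : MemLp (fun p : S × S => g p.1 p.2) 2 (P.prod P))
    (hfs : ∀ x y, f x y = f y x) (hfd : proj P f =ᵐ[P] 0) :
    Tendsto (fun n : ℕ => cov[fun v => (n : ℝ) * uStat f v, fun v => (n : ℝ) * uStat g v;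
        Measure.pi fun _ : Fin n => P]) atTop
      (𝓝 (2 * ∫ p, f p.1 p.2 * g p.1 p.2 ∂(P.prod P))) := by
  refine (tendsto_sq_mul_inv_choose_two.mul_const _).congr fun n => ?_
  rw [covariance_const_mul_left, covariance_const_mul_right, cov_uStat_of_degenerate hf hg hfs hfd]
  ring

end Moments

/-! ### The Hoeffding decomposition. -/

section Hoeffding

variable {S : Type*} [MeasurableSpace S] {P : Measure S} {n : ℕ}

lemma measurable_proj [IsProbabilityMeasure P] {g : S → S → ℝ}
    (hg : Measurable (Function.uncurry g)) :
    Measurable (proj P g) :=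
  (hg.stronglyMeasurable.integral_prod_right (ν := P)).measurable

lemma integral_proj [IsProbabilityMeasure P] {g : S → S → ℝ}
    (hg : Integrable (fun p : S × S => g p.1 p.2) (P.prod P)) :
    ∫ x, proj P g x ∂P = ∫ p, g p.1 p.2 ∂(P.prod P) :=
  (integral_prod _ hg).symm

/-- Nonnegativity of the variance of each section gives `(E g(x, ·))² ≤ E g(x, ·)²`, whose right
side is integrable in `x` by Fubini. -/
lemma memLp_proj [IsProbabilityMeasure P] {g : S → S → ℝ} (hm : Measurable (Function.uncurry g))
    (hg : MemLp (fun p : S × S => g p.1 p.2) 2 (P.prod P)) : MemLp (proj P g) 2 P := by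
  have hsq := hg.integrable_sq
  rw [memLp_two_iff_integrable_sq (measurable_proj hm).aestronglyMeasurable]
  refine hsq.integral_prod_left.mono' ((measurable_proj hm).pow_const 2).aestronglyMeasurable ?_
  filter_upwards [hsq.prod_right_ae] with x hx
  have hL : MemLp (fun y => g x y) 2 P :=
    (memLp_two_iff_integrable_sq (hm.comp measurable_prodMk_left).aestronglyMeasurable).2 hx
  have hv := variance_nonneg (fun y => g x y) P
  rw [variance_eq_sub hL] at hv
  rw [Real.norm_of_nonneg (sq_nonneg _)]
  simpa [proj] using hv

/-- The degenerate part in the Hoeffding decomposition of the kernel `g`. -/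
def degen (P : Measure S) (g : S → S → ℝ) (x y : S) : ℝ :=
  g x y - proj P g x - proj P g y + ∫ p, g p.1 p.2 ∂(P.prod P)

lemma degen_symm {g : S → S → ℝ} (hs : ∀ x y, g x y = g y x) (x y : S) :
    degen P g x y = degen P g y x := by
  rw [degen, degen, hs x y]; ring

lemma memLp_degen [IsProbabilityMeasure P] {g : S → S → ℝ} (hm : Measurable (Function.uncurry g))
    (hg : MemLp (fun p : S × S => g p.1 p.2) 2 (P.prod P)) :
    MemLp (fun p : S × S => degen P g p.1 p.2) 2 (P.prod P) :=
  ((hg.sub ((memLp_proj hm hg).comp_measurePreserving measurePreserving_fst)).sub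
    ((memLp_proj hm hg).comp_measurePreserving measurePreserving_snd)).add (memLp_const _)

lemma proj_degen [IsProbabilityMeasure P] {g : S → S → ℝ} (hm : Measurable (Function.uncurry g))
    (hg : MemLp (fun p : S × S => g p.1 p.2) 2 (P.prod P)) : proj P (degen P g) =ᵐ[P] 0 := by
  filter_upwards [(hg.integrable one_le_two).prod_right_ae] with x hx
  have hp := (memLp_proj hm hg).integrable one_le_two
  have hx' : Integrable (fun y => g x y - proj P g x) P := hx.sub (integrable_const _)
  simp only [Pi.zero_apply]
  rw [proj]
  have hx'' : Integrable (fun y => g x y - proj P g x - proj P g y) P := hx'.sub hp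
  simp only [degen]
  rw [integral_add hx'' (integrable_const _), integral_sub hx' hp,
    integral_sub hx (integrable_const _), integral_proj (hg.integrable one_le_two)]
  simp [proj]

/-- Each index belongs to `n - 1` pairs: swapping turns second members into first members, and the
pairs `i < j` and `j < i` together are all pairs off the diagonal. -/
lemma sum_pairs_add (a : Fin n → ℝ) :
    ∑ p ∈ pairs n, (a p.1 + a p.2) = ((n : ℝ) - 1) * ∑ i, a i := by
  have hs : ∑ p ∈ pairs n, a p.2 = ∑ p ∈ Finset.univ.filter
      (fun p : Fin n × Fin n => p.2 < p.1), a p.1 := by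
    refine Finset.sum_nbij' Prod.swap Prod.swap ?_ ?_ ?_ ?_ ?_ <;> simp [pairs]
  have hsplit : ∀ p : Fin n × Fin n, (if p.1 < p.2 then a p.1 else 0) +
      (if p.2 < p.1 then a p.1 else 0) = a p.1 - if p.2 = p.1 then a p.1 else 0 := by
    intro p
    rcases lt_trichotomy p.1 p.2 with h | h | h
    · simp [h, h.not_gt, h.ne']
    · simp [h]
    · simp [h, h.not_gt, h.ne]
  rw [Finset.sum_add_distrib, hs, pairs, Finset.sum_filter, Finset.sum_filter,
    ← Finset.sum_add_distrib, Finset.sum_congr rfl fun p _ => hsplit p, Fintype.sum_prod_type,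
    Finset.mul_sum]
  refine Finset.sum_congr rfl fun i _ => ?_
  simp [Finset.sum_sub_distrib]
  ring

/-- The Hoeffding decomposition of a `U`-statistic of order two. -/
lemma uStat_sub_eq (g : S → S → ℝ) (hn : 2 ≤ n) (v : Fin n → S) :
    uStat g v - ∫ p, g p.1 p.2 ∂(P.prod P) =
      2 / n * ∑ i, (proj P g (v i) - ∫ p, g p.1 p.2 ∂(P.prod P)) + uStat (degen P g) v := by
  set θ := ∫ p, g p.1 p.2 ∂(P.prod P) with hθ
  have hN := choose_two_pos hn
  have hsum : ∑ p ∈ pairs n, g (v p.1) (v p.2) = ((n : ℝ) - 1) * ∑ i, (proj P g (v i) - θ) +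
      ∑ p ∈ pairs n, degen P g (v p.1) (v p.2) + ((n.choose 2 : ℕ) : ℝ) * θ := by
    rw [← sum_pairs_add, ← Finset.sum_add_distrib, ← card_pairs, ← nsmul_eq_mul,
      ← Finset.sum_const, ← Finset.sum_add_distrib]
    refine Finset.sum_congr rfl fun p _ => ?_
    rw [degen, ← hθ]; ring
  have hn' : (2 : ℝ) ≤ n := by exact_mod_cast hn
  have h1 : (n : ℝ) - 1 ≠ 0 := by linarith
  have h2 : (n : ℝ) ≠ 0 := by linarith
  rw [uStat_eq_sum_pairs, uStat_eq_sum_pairs, hsum, cast_choose_two]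
  field_simp
  ring

end Hoeffding

/-! ### Convergence in measure. -/

section InMeasure

variable {Ω ι : Type*} [MeasurableSpace Ω] {μ : Measure Ω} {l : Filter ι}

/-- As the limit is constant, continuity at that single point suffices. This is what admits matrix
inversion, which is not continuous at every singular matrix. -/
lemma tendstoInMeasure_comp_of_continuousAt {E F : Type*} [PseudoMetricSpace E]
    [PseudoMetricSpace F] {X : ι → Ω → E} {x : E} {G : E → F} (hX : TendstoInMeasure μ X l fun _ => x)
    (hG : ContinuousAt G x) : TendstoInMeasure μ (fun i ω => G (X i ω)) l fun _ => G x := by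
  rw [tendstoInMeasure_iff_dist] at hX ⊢
  intro ε hε
  obtain ⟨δ, hδ, h⟩ := Metric.continuousAt_iff.1 hG ε hε
  refine tendsto_of_tendsto_of_tendsto_of_le_of_le tendsto_const_nhds (hX δ hδ)
    (fun _ => zero_le) fun i => measure_mono fun ω hω => ?_
  by_contra hlt
  exact absurd (h (not_le.1 hlt)) (not_lt.2 hω)

lemma tendstoInMeasure_pi {κ : Type*} [Fintype κ] {E : κ → Type*} [∀ k, PseudoMetricSpace (E k)]
    {X : ι → Ω → ∀ k, E k} {x : Ω → ∀ k, E k}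
    (hX : ∀ k, TendstoInMeasure μ (fun i ω => X i ω k) l fun ω => x ω k) :
    TendstoInMeasure μ X l x := by
  simp_rw [tendstoInMeasure_iff_dist] at hX ⊢
  intro ε hε
  have hs : Tendsto (fun i => ∑ k, μ {ω | ε ≤ dist (X i ω k) (x ω k)}) l (𝓝 0) := by
    simpa using tendsto_finsetSum Finset.univ fun k _ => hX k ε hε
  refine tendsto_of_tendsto_of_tendsto_of_le_of_le tendsto_const_nhds hs
    (fun _ => zero_le) fun i => ?_
  refine (measure_mono fun ω hω => ?_).trans (measure_iUnion_fintype_le μ _)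
  by_contra hlt
  simp only [Set.mem_iUnion, Set.mem_ofPred_eq, not_exists, not_le] at hlt hω
  exact absurd ((dist_pi_lt_iff hε).2 hlt) (not_lt.2 hω)

lemma tendstoInMeasure_prodMk {E F : Type*} [PseudoMetricSpace E] [PseudoMetricSpace F]
    {X : ι → Ω → E} {x : Ω → E} {Y : ι → Ω → F} {y : Ω → F}
    (hX : TendstoInMeasure μ X l x) (hY : TendstoInMeasure μ Y l y) :
    TendstoInMeasure μ (fun i ω => (X i ω, Y i ω)) l fun ω => (x ω, y ω) := by
  rw [tendstoInMeasure_iff_dist] at hX hY ⊢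
  intro ε hε
  have hs := (hX ε hε).add (hY ε hε)
  rw [add_zero] at hs
  refine tendsto_of_tendsto_of_tendsto_of_le_of_le tendsto_const_nhds hs
    (fun _ => zero_le) fun i => ?_
  refine (measure_mono fun ω hω => ?_).trans (measure_union_le _ _)
  exact le_max_iff.1 (show ε ≤ max (dist (X i ω) (x ω)) (dist (Y i ω) (y ω)) from hω)

lemma eLpNorm_two_eq_ofReal_sqrt {X : Ω → ℝ} (hX : MemLp X 2 μ) :
    eLpNorm X 2 μ = ENNReal.ofReal √(∫ ω, X ω ^ 2 ∂μ) := by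
  rw [hX.eLpNorm_eq_integral_rpow_norm two_ne_zero ENNReal.ofNat_ne_top, Real.sqrt_eq_rpow]
  simp

lemma tendstoInMeasure_zero_of_tendsto_integral_sq {X : ι → Ω → ℝ} (hX : ∀ i, MemLp (X i) 2 μ)
    (h : Tendsto (fun i => ∫ ω, X i ω ^ 2 ∂μ) l (𝓝 0)) : TendstoInMeasure μ X l 0 := by
  refine tendstoInMeasure_of_tendsto_eLpNorm two_ne_zero (fun i => (hX i).1)
    aestronglyMeasurable_const ?_
  simp_rw [sub_zero, fun i => eLpNorm_two_eq_ofReal_sqrt (hX i)]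
  simpa using ENNReal.tendsto_ofReal ((Real.continuous_sqrt.tendsto 0).comp (by simpa using h))

end InMeasure

/-! ### The multivariate central limit theorem. -/

section CentralLimit

variable {Ω S : Type*} [MeasurableSpace Ω] [MeasurableSpace S] {μ : Measure Ω}
  [IsProbabilityMeasure μ] {P : Measure S} [IsProbabilityMeasure P]

/-- This is the scalar central limit theorem at one frequency: normalise `f` to unit variance and
evaluate at `√V`. When `V = 0` normalisation is impossible, but then `f` vanishes almost everywhere.
-/
lemma tendsto_charFun_pow {f : S → ℝ} (hf : MemLp f 2 P) (h0 : ∫ x, f x ∂P = 0) :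
    Tendsto (fun n : ℕ => charFun (P.map f) (√(n : ℝ))⁻¹ ^ n) atTop
      (𝓝 (Complex.exp (-((∫ x, f x ^ 2 ∂P : ℝ) : ℂ) / 2))) := by
  have hfm : AEMeasurable f P := hf.1.aemeasurable
  set V := ∫ x, f x ^ 2 ∂P with hV
  have hV0 : 0 ≤ V := integral_nonneg fun x => sq_nonneg _
  rcases hV0.eq_or_lt with hv | hv
  · have hz : f =ᵐ[P] fun _ => 0 := by
      have := (integral_eq_zero_iff_of_nonneg (fun x => sq_nonneg (f x)) hf.integrable_sq).1 hv.symm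
      filter_upwards [this] with x hx
      simpa using hx
    rw [Measure.map_congr hz, ← hv]
    simp
  · have hs : √V ≠ 0 := (Real.sqrt_pos.2 hv).ne'
    have h := tendsto_charFun_inv_sqrt_mul_pow (P := P) (X := fun x => (√V)⁻¹ * f x)
      (hfm.const_mul _) (by rw [integral_const_mul, h0, mul_zero])
      (by
        simp only [Pi.pow_apply, mul_pow]
        rw [integral_const_mul, ← hV, inv_pow, Real.sq_sqrt hV0, inv_mul_cancel₀ hv.ne']) √V
    have he : (Complex.exp (-((√V : ℝ) : ℂ) ^ 2 / 2)) = Complex.exp (-(V : ℂ) / 2) := by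
      rw [← Complex.ofReal_pow, Real.sq_sqrt hV0]
    rw [he] at h
    refine h.congr fun n => ?_
    rw [charFun_map_mul_comp hfm]
    congr 2
    field_simp

variable {c : ℕ}

/-- The Gram matrix `E[f_a f_b]`. -/
def gram (P : Measure S) (f : Fin c → S → ℝ) : Matrix (Fin c) (Fin c) ℝ :=
  Matrix.of fun a b => ∫ x, f a x * f b x ∂P

-- Expanding the square makes the quadratic form a second moment. It serves both for positivity and
-- for identifying the Gaussian characteristic function.
omit [IsProbabilityMeasure P] in
lemma dotProduct_gram_mulVec {f : Fin c → S → ℝ} (hf : ∀ a, MemLp (f a) 2 P) (t : Fin c → ℝ) :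
    t ⬝ᵥ (gram P f *ᵥ t) = ∫ x, (∑ a, f a x * t a) ^ 2 ∂P := by
  have hint : ∀ a b, Integrable (fun x => f a x * t a * (f b x * t b)) P := fun a b =>
    ((hf a).mul_const (t a)).integrable_mul ((hf b).mul_const (t b))
  simp_rw [sq, Finset.sum_mul_sum]
  rw [integral_finsetSum _ fun a _ => integrable_finsetSum _ fun b _ => hint a b]
  simp_rw [dotProduct, mulVec, dotProduct, Finset.mul_sum]
  refine Finset.sum_congr rfl fun a _ => ?_
  rw [integral_finsetSum _ fun b _ => hint a b]
  refine Finset.sum_congr rfl fun b _ => ?_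
  rw [gram, Matrix.of_apply, ← integral_mul_const, ← integral_const_mul]
  exact integral_congr_ae (ae_of_all _ fun x => by ring)

omit [IsProbabilityMeasure P] in
lemma posSemidef_gram {f : Fin c → S → ℝ} (hf : ∀ a, MemLp (f a) 2 P) :
    (gram P f).PosSemidef := by
  refine Matrix.PosSemidef.of_dotProduct_mulVec_nonneg ?_ fun t => ?_
  · ext a b
    simp [gram, mul_comm]
  · rw [star_trivial, dotProduct_gram_mulVec hf]
    exact integral_nonneg fun x => sq_nonneg _

/-- The central limit theorem for i.i.d. vectors, each sum being computed from its own sample. -/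
theorem tendstoInDistribution_multivariate {W : (n : ℕ) → Fin n → Ω → S}
    (hW : ∀ n, HasLaw (fun ω i => W n i ω) (Measure.pi fun _ => P) μ) {f : Fin c → S → ℝ}
    (hm : ∀ a, Measurable (f a)) (hf : ∀ a, MemLp (f a) 2 P) (h0 : ∀ a, ∫ x, f a x ∂P = 0) :
    TendstoInDistribution
      (fun (n : ℕ) ω => WithLp.toLp 2 fun a => (√(n : ℝ))⁻¹ * ∑ i, f a (W n i ω)) atTop
      (id : EuclideanSpace ℝ (Fin c) → EuclideanSpace ℝ (Fin c)) (fun _ => μ)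
      (multivariateGaussian 0 (gram P f)) where
  forall_aemeasurable n := by
    have : Measurable fun v : Fin n → S => WithLp.toLp 2 fun a => (√(n : ℝ))⁻¹ * ∑ i, f a (v i) := by
      refine (by fun_prop : Measurable (WithLp.toLp 2 : (Fin c → ℝ) → _)).comp
        (measurable_pi_lambda _ fun a => ?_)
      exact (Finset.measurable_sum _ fun i _ => (hm a).comp (measurable_pi_apply i)).const_mul _
    exact this.comp_aemeasurable (hW n).aemeasurable
  tendsto := by
    -- By Lévy's theorem and linearity in `t`, the problem reduces to the scalar function `∑ a, f a
    -- x * t a` at frequency `(√n)⁻¹`. Only the law of each sample matters, so samples of different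
    -- sizes may be related in any way.
    refine ProbabilityMeasure.tendsto_iff_tendsto_charFun.2 fun t => ?_
    simp only [ProbabilityMeasure.coe_mk, Measure.map_id]
    rw [charFun_multivariateGaussian (posSemidef_gram hf), dotProduct_gram_mulVec hf]
    have hF : MemLp (fun x => ∑ a, f a x * t a) 2 P :=
      memLp_finsetSum _ fun a _ => (hf a).mul_const (t a)
    have hF0 : ∫ x, ∑ a, f a x * t a ∂P = 0 := by
      rw [integral_finsetSum _ fun a _ => ((hf a).mul_const (t a)).integrable one_le_two]
      simp [integral_mul_const, h0]
    have hFm : Measurable (fun x => ∑ a, f a x * t a) :=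
      Finset.measurable_sum _ fun a _ => (hm a).mul_const (t a)
    have key := tendsto_charFun_pow hF hF0
    convert key using 2 with n
    · have hv : Measurable fun v : Fin n → S =>
          WithLp.toLp 2 fun a => (√(n : ℝ))⁻¹ * ∑ i, f a (v i) := by
        refine (by fun_prop : Measurable (WithLp.toLp 2 : (Fin c → ℝ) → _)).comp
          (measurable_pi_lambda _ fun a => ?_)
        exact (Finset.measurable_sum _ fun i _ => (hm a).comp (measurable_pi_apply i)).const_mul _
      have hl : μ.map (fun ω => WithLp.toLp 2 fun a => (√(n : ℝ))⁻¹ * ∑ i, f a (W n i ω)) =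
          (Measure.pi fun _ : Fin n => P).map
            fun v => WithLp.toLp 2 fun a => (√(n : ℝ))⁻¹ * ∑ i, f a (v i) := by
        rw [← (hW n).map_eq, AEMeasurable.map_map_of_aemeasurable hv.aemeasurable
          (hW n).aemeasurable]
        rfl
      rw [hl, charFun_apply, integral_map hv.aemeasurable (by fun_prop), charFun_apply_real,
        integral_map hFm.aemeasurable (by fun_prop)]
      -- The exponential factors over the sample points, so independence makes the characteristic
      -- function an `n`-th power.
      have hexp : ∀ v : Fin n → S, Complex.exp
          ((inner ℝ (WithLp.toLp 2 fun a => (√(n : ℝ))⁻¹ * ∑ i, f a (v i)) t : ℝ) * Complex.I) =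
          ∏ i, Complex.exp (((√(n : ℝ))⁻¹ : ℝ) * ((∑ a, f a (v i) * t a : ℝ) : ℂ) * Complex.I) := by
        intro v
        rw [← Complex.exp_sum, ← Finset.sum_mul]
        congr 2
        rw [← Finset.mul_sum]
        push_cast [PiLp.inner_apply]
        simp only [RCLike.inner_apply, conj_trivial]
        push_cast
        rw [Finset.sum_comm, Finset.mul_sum]
        refine Finset.sum_congr rfl fun a _ => ?_
        rw [← Finset.sum_mul]; ring
      simp_rw [hexp]
      rw [integral_fintype_prod_eq_prod (f := fun (_ : Fin n) x =>
        Complex.exp (((√(n : ℝ))⁻¹ : ℝ) * ((∑ a, f a x * t a : ℝ) : ℂ) * Complex.I))]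
      simp
    · simp [neg_div]

end CentralLimit

/-! ### Moments of the linear part and its orthogonality to the degenerate part. -/

section Covariance

variable {S : Type*} [MeasurableSpace S] {P : Measure S} [IsProbabilityMeasure P] {n : ℕ}

lemma memLp_eval {f : S → ℝ} {q : ℝ≥0∞} (hf : MemLp f q P) (i : Fin n) :
    MemLp (fun v : Fin n → S => f (v i)) q (Measure.pi fun _ : Fin n => P) :=
  hf.comp_measurePreserving (measurePreserving_eval (fun _ : Fin n => P) i)

lemma memLp_sum_eval {f : S → ℝ} {q : ℝ≥0∞} (hf : MemLp f q P) :
    MemLp (fun v : Fin n → S => ∑ i, f (v i)) q (Measure.pi fun _ : Fin n => P) :=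
  memLp_finsetSum _ fun i _ => memLp_eval hf i

lemma integral_sum_mul_sum {f g : S → ℝ} (hf : MemLp f 2 P) (hg : MemLp g 2 P)
    (hf0 : ∫ x, f x ∂P = 0) :
    ∫ v, (∑ i, f (v i)) * (∑ i, g (v i)) ∂(Measure.pi fun _ : Fin n => P) =
      n * ∫ x, f x * g x ∂P := by
  have hint : ∀ i j : Fin n, Integrable (fun v : Fin n → S => f (v i) * g (v j))
      (Measure.pi fun _ : Fin n => P) := fun i j =>
    (memLp_eval hf i).integrable_mul (memLp_eval hg j)
  simp_rw [Finset.sum_mul_sum]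
  rw [integral_finsetSum _ fun i _ => integrable_finsetSum _ fun j _ => hint i j]
  have hi : ∀ i : Fin n, ∫ v, ∑ j, f (v i) * g (v j) ∂(Measure.pi fun _ : Fin n => P) =
      ∫ x, f x * g x ∂P := by
    intro i
    rw [integral_finsetSum _ fun j _ => hint i j, Finset.sum_eq_single i]
    · exact (measurePreserving_eval (fun _ : Fin n => P) i).hasLaw.integral_comp
        (f := fun x => f x * g x) (hf.integrable_mul hg).1
    · intro j _ hj
      have hfg : Integrable (fun p : S × S => f p.1 * g p.2) (P.prod P) :=
        (hf.integrable one_le_two).mul_prod (hg.integrable one_le_two)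
      rw [integral_eval_pair (g := fun x y => f x * g y) hfg.1 hj.symm, integral_prod_mul, hf0,
        zero_mul]
    · exact fun h => absurd (Finset.mem_univ i) h
  rw [Finset.sum_congr rfl fun i _ => hi i]
  simp

/-- For a pair and an index `i`, at least one point of the pair differs from `i`; integrating over
it gives zero, after a swap by symmetry if `i` is the second point. -/
lemma integral_sum_mul_uStat {f : S → ℝ} {g : S → S → ℝ} (hf : MemLp f 2 P)
    (hg : MemLp (fun p : S × S => g p.1 p.2) 2 (P.prod P))
    (hs : ∀ x y, g x y = g y x) (hd : proj P g =ᵐ[P] 0) :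
    ∫ v, (∑ i, f (v i)) * uStat g v ∂(Measure.pi fun _ : Fin n => P) = 0 := by
  have hint : ∀ p ∈ pairs n, ∀ i, Integrable (fun v : Fin n → S => g (v p.1) (v p.2) * f (v i))
      (Measure.pi fun _ : Fin n => P) := fun p hp i =>
    (memLp_eval_pair hg (mem_pairs.1 hp).ne).integrable_mul (memLp_eval hf i)
  have hexp : ∀ v : Fin n → S, (∑ i, f (v i)) * uStat g v =
      ((n.choose 2 : ℕ) : ℝ)⁻¹ * ∑ p ∈ pairs n, ∑ i, g (v p.1) (v p.2) * f (v i) := by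
    intro v
    rw [uStat_eq_sum_pairs, ← Finset.sum_mul_sum]
    ring
  simp_rw [hexp]
  rw [integral_const_mul, integral_finsetSum _ fun p hp => integrable_finsetSum _ fun i _ =>
    hint p hp i]
  refine mul_eq_zero_of_right _ (Finset.sum_eq_zero fun p hp => ?_)
  rw [integral_finsetSum _ fun i _ => hint p hp i]
  refine Finset.sum_eq_zero fun i _ => ?_
  have hp' := mem_pairs.1 hp
  by_cases h2 : p.2 = i
  · have h1 : i ≠ p.1 := by rw [← h2]; exact hp'.ne'
    have hs' : ∀ v : Fin n → S, g (v p.1) (v p.2) = g (v p.2) (v p.1) := fun v => hs _ _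
    have hi := hint p hp i
    simp only [hs'] at hi ⊢
    exact integral_mul_eq_zero_of_degenerate hd hp'.ne'
      (fun v y => by rw [Function.update_of_ne h1]) hi
  · exact integral_mul_eq_zero_of_degenerate hd hp'.ne
      (fun v y => by rw [Function.update_of_ne (Ne.symm h2)]) (hint p hp i)

end Covariance

/-! ### Covariances, weak law and central limit theorem under the alternative. -/

section Alternative

variable {S : Type*} [MeasurableSpace S] {P : Measure S} [IsProbabilityMeasure P] {c : ℕ}
  {h : Fin c → S → S → ℝ}

/-- The influence functions `2 (h₁ - U)` of the `U`-statistics. -/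
def influence (P : Measure S) (h : Fin c → S → S → ℝ) (a : Fin c) (x : S) : ℝ :=
  2 * (proj P (h a) x - uPop P h a)

lemma measurable_influence (hm : ∀ a, Measurable (Function.uncurry (h a))) (a : Fin c) :
    Measurable (influence P h a) :=
  ((measurable_proj (hm a)).sub_const _).const_mul _

lemma memLp_influence (hm : ∀ a, Measurable (Function.uncurry (h a)))
    (hL : ∀ a, MemLp (fun p : S × S => h a p.1 p.2) 2 (P.prod P)) (a : Fin c) :
    MemLp (influence P h a) 2 P :=
  ((memLp_proj (hm a) (hL a)).sub (memLp_const _)).const_mul _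

lemma integral_influence (hm : ∀ a, Measurable (Function.uncurry (h a)))
    (hL : ∀ a, MemLp (fun p : S × S => h a p.1 p.2) 2 (P.prod P)) (a : Fin c) :
    ∫ x, influence P h a x ∂P = 0 := by
  simp_rw [influence]
  rw [integral_const_mul, integral_sub ((memLp_proj (hm a) (hL a)).integrable one_le_two)
    (integrable_const _), integral_proj ((hL a).integrable one_le_two)]
  simp [uPop]

lemma gram_influence (hm : ∀ a, Measurable (Function.uncurry (h a)))
    (hL : ∀ a, MemLp (fun p : S × S => h a p.1 p.2) 2 (P.prod P)) :
    gram P (influence P h) = sigmaAlt P h := by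
  ext a b
  have hp := fun a => memLp_proj (hm a) (hL a)
  have hi := fun a => (hp a).integrable one_le_two
  have hab : Integrable (fun x => proj P (h a) x * proj P (h b) x) P :=
    (hp a).integrable_mul (hp b)
  have e : ∀ x, influence P h a x * influence P h b x =
      4 * ((proj P (h a) x * proj P (h b) x - uPop P h b * proj P (h a) x) -
        (uPop P h a * proj P (h b) x - uPop P h a * uPop P h b)) := by
    intro x; simp only [influence]; ring
  simp only [gram, sigmaAlt, Matrix.of_apply, e]
  have h1 : Integrable (fun x => uPop P h b * proj P (h a) x) P := (hi a).const_mul _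
  have h2 : Integrable (fun x => uPop P h a * proj P (h b) x) P := (hi b).const_mul _
  have h3 : Integrable (fun x => proj P (h a) x * proj P (h b) x - uPop P h b * proj P (h a) x) P :=
    hab.sub h1
  have h4 : Integrable (fun x => uPop P h a * proj P (h b) x - uPop P h a * uPop P h b) P :=
    h2.sub (integrable_const _)
  rw [integral_const_mul, integral_sub h3 h4,
    integral_sub hab h1, integral_sub h2 (integrable_const _), integral_const_mul,
    integral_const_mul, integral_proj ((hL a).integrable one_le_two),
    integral_proj ((hL b).integrable one_le_two)]
  simp only [uPop, integral_const, probReal_univ, one_smul]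
  ring

omit [IsProbabilityMeasure P] in
lemma uStat_sub_uPop {n : ℕ} (hn : 2 ≤ n) (a : Fin c) (v : Fin n → S) :
    uStat (h a) v - uPop P h a =
      (n : ℝ)⁻¹ * ∑ i, influence P h a (v i) + uStat (degen P (h a)) v := by
  rw [uPop, uStat_sub_eq _ hn]
  simp only [influence, uPop, ← Finset.mul_sum]
  ring

/-- The two Hoeffding parts are orthogonal, so the cross terms drop out: the linear parts contribute
the term in `n⁻¹`, the degenerate parts the one in `(n choose 2)⁻¹`. -/
lemma cov_uStat (hm : ∀ a, Measurable (Function.uncurry (h a)))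
    (hs : ∀ a x y, h a x y = h a y x)
    (hL : ∀ a, MemLp (fun p : S × S => h a p.1 p.2) 2 (P.prod P)) {n : ℕ} (hn : 2 ≤ n)
    (a b : Fin c) :
    cov[fun v => uStat (h a) v, fun v => uStat (h b) v; Measure.pi fun _ : Fin n => P] =
      (n : ℝ)⁻¹ * sigmaAlt P h a b + ((n.choose 2 : ℕ) : ℝ)⁻¹ *
        ∫ p, degen P (h a) p.1 p.2 * degen P (h b) p.1 p.2 ∂(P.prod P) := by
  have hq := fun a => memLp_degen (hm a) (hL a)
  have hqs := fun a => degen_symm (P := P) (hs a)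
  have hqd := fun a => proj_degen (hm a) (hL a)
  have hf := memLp_influence hm hL
  have hmean : ∀ a, ∫ v, uStat (h a) v ∂(Measure.pi fun _ : Fin n => P) = uPop P h a :=
    fun a => integral_uStat ((hL a).integrable one_le_two) hn
  have hA : ∀ a, MemLp (fun v : Fin n → S => ∑ i, influence P h a (v i)) 2
      (Measure.pi fun _ : Fin n => P) := fun a => memLp_sum_eval (hf a)
  have hR : ∀ a, MemLp (fun v : Fin n → S => uStat (degen P (h a)) v) 2
      (Measure.pi fun _ : Fin n => P) := fun a => memLp_uStat (hq a)
  have e : ∀ v : Fin n → S, (uStat (h a) v - uPop P h a) * (uStat (h b) v - uPop P h b) =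
      ((n : ℝ)⁻¹ * (n : ℝ)⁻¹) * ((∑ i, influence P h a (v i)) * ∑ i, influence P h b (v i)) +
      (n : ℝ)⁻¹ * ((∑ i, influence P h a (v i)) * uStat (degen P (h b)) v) +
      (n : ℝ)⁻¹ * ((∑ i, influence P h b (v i)) * uStat (degen P (h a)) v) +
      uStat (degen P (h a)) v * uStat (degen P (h b)) v := by
    intro v
    rw [uStat_sub_uPop hn, uStat_sub_uPop hn]; ring
  have i1 := ((hA a).integrable_mul (hA b)).const_mul ((n : ℝ)⁻¹ * (n : ℝ)⁻¹)
  have i2 := ((hA a).integrable_mul (hR b)).const_mul (n : ℝ)⁻¹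
  have i3 := ((hA b).integrable_mul (hR a)).const_mul (n : ℝ)⁻¹
  have i4 := (hR a).integrable_mul (hR b)
  simp only [Pi.mul_apply, Pi.mul_def] at i1 i2 i3 i4
  rw [covariance]
  simp_rw [hmean, e]
  rw [integral_add ((i1.fun_add i2).fun_add i3) i4, integral_add (i1.fun_add i2) i3, integral_add i1 i2,
    integral_const_mul, integral_const_mul, integral_const_mul,
    integral_sum_mul_sum (hf a) (hf b) (integral_influence hm hL a),
    integral_sum_mul_uStat (hf a) (hq b) (hqs b) (hqd b),
    integral_sum_mul_uStat (hf b) (hq a) (hqs a) (hqd a),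
    integral_uStat_mul_uStat (hq a) (hq b) (hqs a) (hqd a), ← gram_influence hm hL]
  have h0 : (n : ℝ) ≠ 0 := by
    have : n ≠ 0 := by omega
    exact_mod_cast this
  simp only [gram, Matrix.of_apply]
  field_simp
  ring

lemma tendsto_cov_sqrt_mul_uStat (hm : ∀ a, Measurable (Function.uncurry (h a)))
    (hs : ∀ a x y, h a x y = h a y x)
    (hL : ∀ a, MemLp (fun p : S × S => h a p.1 p.2) 2 (P.prod P)) (a b : Fin c) :
    Tendsto (fun n : ℕ => cov[fun v => √(n : ℝ) * uStat (h a) v,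
        fun v => √(n : ℝ) * uStat (h b) v; Measure.pi fun _ : Fin n => P]) atTop
      (𝓝 (sigmaAlt P h a b)) := by
  have ht := (tendsto_mul_inv_choose_two.mul_const
    (∫ p, degen P (h a) p.1 p.2 * degen P (h b) p.1 p.2 ∂(P.prod P))).const_add (sigmaAlt P h a b)
  rw [zero_mul, add_zero] at ht
  refine ht.congr' ?_
  filter_upwards [eventually_ge_atTop 2] with n hn
  have h0 : (n : ℝ) ≠ 0 := by
    have : n ≠ 0 := by omega
    exact_mod_cast this
  rw [covariance_const_mul_left, covariance_const_mul_right, cov_uStat hm hs hL hn, ← mul_assoc,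
    Real.mul_self_sqrt (Nat.cast_nonneg n)]
  field_simp

variable {Ω : Type*} [MeasurableSpace Ω] {μ : Measure Ω} [IsProbabilityMeasure μ]
  {W : (n : ℕ) → Fin n → Ω → S}

omit [IsProbabilityMeasure μ] in
lemma memLp_comp_of_hasLaw {X : Type*} [MeasurableSpace X] {ν : Measure X} {Y : Ω → X}
    (hY : HasLaw Y ν μ) {f : X → ℝ} {q : ℝ≥0∞} (hf : MemLp f q ν) :
    MemLp (fun ω => f (Y ω)) q μ := by
  rw [← hY.map_eq] at hf
  exact hf.comp_of_map hY.aemeasurable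

omit [IsProbabilityMeasure μ] in
lemma tendstoInMeasure_uVec (hW : ∀ n, HasLaw (fun ω i => W n i ω) (Measure.pi fun _ => P) μ)
    (hm : ∀ a, Measurable (Function.uncurry (h a)))
    (hs : ∀ a x y, h a x y = h a y x)
    (hL : ∀ a, MemLp (fun p : S × S => h a p.1 p.2) 2 (P.prod P)) :
    TendstoInMeasure μ (fun n ω => uVec h (fun i => W n i ω)) atTop fun _ => uPop P h := by
  refine tendstoInMeasure_pi fun a => ?_
  have hmem : ∀ n, MemLp (fun v : Fin n → S => uStat (h a) v - uPop P h a) 2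
      (Measure.pi fun _ => P) := fun n => (memLp_uStat (hL a)).sub (memLp_const _)
  have h0 : TendstoInMeasure μ (fun n ω => uStat (h a) (fun i => W n i ω) - uPop P h a) atTop 0 := by
    refine tendstoInMeasure_zero_of_tendsto_integral_sq
      (fun n => memLp_comp_of_hasLaw (hW n) (hmem n)) ?_
    -- `n` times the variance converges, so the variance itself tends to `0`; Chebyshev's inequality
    -- does the rest.
    have ht := (tendsto_cov_sqrt_mul_uStat hm hs hL a a).mul
      (tendsto_inv_atTop_nhds_zero_nat (𝕜 := ℝ))
    rw [mul_zero] at ht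
    refine ht.congr' ?_
    filter_upwards [eventually_ge_atTop 2] with n hn
    have hn0 : (n : ℝ) ≠ 0 := by
      have : n ≠ 0 := by omega
      exact_mod_cast this
    have hi := (hW n).integral_comp (f := fun v => (uStat (h a) v - uPop P h a) ^ 2)
      (hmem n).integrable_sq.1
    rw [Function.comp_def] at hi
    rw [hi, covariance_const_mul_left, covariance_const_mul_right, covariance,
      integral_uStat ((hL a).integrable one_le_two) hn, ← mul_assoc,
      Real.mul_self_sqrt (Nat.cast_nonneg n)]
    simp only [uPop, ← sq]
    field_simp
  rw [tendstoInMeasure_iff_norm] at h0 ⊢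
  simpa [uVec] using h0

/-- The central limit theorem for vectors of nondegenerate `U`-statistics. -/
theorem tendstoInDistribution_uVec
    (hW : ∀ n, HasLaw (fun ω i => W n i ω) (Measure.pi fun _ => P) μ)
    (hm : ∀ a, Measurable (Function.uncurry (h a)))
    (hs : ∀ a x y, h a x y = h a y x)
    (hL : ∀ a, MemLp (fun p : S × S => h a p.1 p.2) 2 (P.prod P)) :
    TendstoInDistribution
      (fun (n : ℕ) ω => WithLp.toLp 2
        (√(n : ℝ) • (uVec h (fun i => W n i ω) - uPop P h)))
      atTop (id : EuclideanSpace ℝ (Fin c) → EuclideanSpace ℝ (Fin c)) (fun _ => μ)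
      (multivariateGaussian 0 (sigmaAlt P h)) := by
  rw [← gram_influence hm hL]
  -- It suffices that the difference from the normalised sum of influence functions, namely `√n`
  -- times the degenerate part, vanishes in measure. Its second moment is of order `n / (n choose
  -- 2)`.
  refine tendstoInDistribution_of_tendstoInMeasure_sub _ _
    (tendstoInDistribution_multivariate hW (measurable_influence hm) (memLp_influence hm hL)
      (integral_influence hm hL)) ?_ ?_
  · have hR : TendstoInMeasure μ
        (fun (n : ℕ) ω (a : Fin c) => √(n : ℝ) * uStat (degen P (h a)) (fun i => W n i ω)) atTop
        fun _ => (0 : Fin c → ℝ) := by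
      refine tendstoInMeasure_pi fun a => ?_
      have hq := memLp_degen (hm a) (hL a)
      have hmem : ∀ n : ℕ, MemLp (fun v : Fin n → S => √(n : ℝ) * uStat (degen P (h a)) v) 2
          (Measure.pi fun _ => P) := fun n => (memLp_uStat hq).const_mul _
      refine tendstoInMeasure_zero_of_tendsto_integral_sq
        (fun n => memLp_comp_of_hasLaw (hW n) (hmem n)) ?_
      have ht := tendsto_mul_inv_choose_two.mul_const
        (∫ p, degen P (h a) p.1 p.2 * degen P (h a) p.1 p.2 ∂(P.prod P))
      rw [zero_mul] at ht
      refine ht.congr fun n => ?_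
      have hi := (hW n).integral_comp (f := fun v => (√(n : ℝ) * uStat (degen P (h a)) v) ^ 2)
        (hmem n).integrable_sq.1
      rw [Function.comp_def] at hi
      rw [hi]
      simp_rw [mul_pow, Real.sq_sqrt (Nat.cast_nonneg (α := ℝ) n)]
      rw [integral_const_mul]
      simp_rw [sq]
      rw [integral_uStat_mul_uStat hq hq (degen_symm (hs a)) (proj_degen (hm a) (hL a)), mul_assoc]
    have hR' := tendstoInMeasure_comp_of_continuousAt (G := (WithLp.toLp 2 : (Fin c → ℝ) → _)) hR
      (PiLp.continuous_toLp 2 _).continuousAt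
    refine hR'.congr' ?_ (by simp; rfl)
    filter_upwards [eventually_ge_atTop 2] with n hn
    refine ae_of_all _ fun ω => ?_
    have hn0 : (n : ℝ) ≠ 0 := by
      have : n ≠ 0 := by omega
      exact_mod_cast this
    ext a
    simp only [Pi.sub_apply, PiLp.sub_apply, Pi.smul_apply, smul_eq_mul, uVec,
      uStat_sub_uPop hn]
    have : (√(n : ℝ)) * (n : ℝ)⁻¹ = (√(n : ℝ))⁻¹ := by
      rw [← div_eq_mul_inv, Real.sqrt_div_self', one_div]
    rw [mul_add, ← mul_assoc, this]
    ring
  · intro n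
    have : Measurable fun v : Fin n → S => WithLp.toLp 2 (√(n : ℝ) • (uVec h v - uPop P h)) := by
      refine (by fun_prop : Measurable (WithLp.toLp 2 : (Fin c → ℝ) → _)).comp
        (measurable_pi_lambda _ fun a => ?_)
      exact ((measurable_uStat (hm a)).sub_const _).const_mul _
    exact this.comp_aemeasurable (hW n).aemeasurable

end Alternative

/-! ### Simulated observations for fixed drawn indices. -/

section PatternLaw

variable {S A : Type*} [MeasurableSpace S] [MeasurableSpace A] {P : Measure S}
  [IsProbabilityMeasure P] {Q : Measure A} [IsProbabilityMeasure Q] {m k : ℕ}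
  {ρ : (Fin k → S) → A → S}

/-- The law of `m` simulated observations, the `t`-th of which uses the data points with the
indices `J t`. -/
def patternLaw {ι : Type*} [Fintype ι] (P : Measure S) (Q : Measure A) (ρ : (Fin k → S) → A → S)
    (J : Fin m → Fin k → ι) : Measure (Fin m → S) :=
  ((Measure.pi fun _ : ι => P).prod (Measure.pi fun _ : Fin m => Q)).map
    fun p t => ρ (fun s => p.1 (J t s)) (p.2 t)

lemma measurable_pattern {ι : Type*} (hρ : Measurable (Function.uncurry ρ))
    (J : Fin m → Fin k → ι) :
    Measurable fun (p : (ι → S) × (Fin m → A)) t => ρ (fun s => p.1 (J t s)) (p.2 t) :=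
  measurable_pi_lambda _ fun t => hρ.comp
    (f := fun p : (ι → S) × (Fin m → A) => ((fun s => p.1 (J t s)), p.2 t)) (by fun_prop)

lemma isProbabilityMeasure_patternLaw {ι : Type*} [Fintype ι] (hρ : Measurable (Function.uncurry ρ))
    (J : Fin m → Fin k → ι) : IsProbabilityMeasure (patternLaw P Q ρ J) :=
  Measure.isProbabilityMeasure_map (measurable_pattern hρ J).aemeasurable

/-- Relabelling the data points does not change the law of the simulated observations. -/
lemma patternLaw_comp_injective {ι κ : Type*} [Fintype ι] [Fintype κ]
    (hρ : Measurable (Function.uncurry ρ)) {f : ι → κ} (hf : f.Injective)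
    (J : Fin m → Fin k → ι) :
    patternLaw P Q ρ (fun t s => f (J t s)) = patternLaw P Q ρ J := by
  have hmp := (measurePreserving_precomp P hf).prod
    (MeasurePreserving.id (Measure.pi fun _ : Fin m => Q))
  rw [patternLaw, patternLaw, ← hmp.map_eq, Measure.map_map (measurable_pattern hρ J) hmp.measurable]
  rfl

/-- Only the coincidences among the drawn indices matter for the law of the simulated
observations; so any pattern is equivalent to one with `m * k` data points. -/
lemma exists_patternLaw_eq {ι : Type*} [Fintype ι] (hρ : Measurable (Function.uncurry ρ))
    (J : Fin m → Fin k → ι) :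
    ∃ I : Fin m → Fin k → Fin (m * k), patternLaw P Q ρ J = patternLaw P Q ρ I := by
  classical
  let T := Set.range fun p : Fin m × Fin k => J p.1 p.2
  let J' : Fin m → Fin k → T := fun t s => ⟨J t s, (t, s), rfl⟩
  let e : T → Fin (m * k) := fun x => finProdFinEquiv x.2.choose
  have he : e.Injective := by
    intro x y hxy
    have h := finProdFinEquiv.injective hxy
    refine Subtype.ext ?_
    rw [← x.2.choose_spec, ← y.2.choose_spec, h]
  refine ⟨fun t s => e (J' t s), ?_⟩
  rw [patternLaw_comp_injective hρ he, ← patternLaw_comp_injective hρ Subtype.val_injective J']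

omit [IsProbabilityMeasure P] in
lemma measurePreserving_curry [SigmaFinite P] {ι κ : Type*} [Fintype ι] [Fintype κ] :
    MeasurePreserving (fun (v : ι × κ → S) i j => v (i, j)) (Measure.pi fun _ : ι × κ => P)
      (Measure.pi fun _ : ι => Measure.pi fun _ : κ => P) := by
  have hu : Measurable fun (v : ι → κ → S) (p : ι × κ) => v p.1 p.2 := by fun_prop
  have h : (Measure.pi fun _ : ι => Measure.pi fun _ : κ => P).map
      (fun (v : ι → κ → S) (p : ι × κ) => v p.1 p.2) = Measure.pi fun _ : ι × κ => P := by
    refine (Measure.pi_eq fun s hs => ?_).symm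
    rw [Measure.map_apply hu (MeasurableSet.univ_pi hs)]
    have : (fun (v : ι → κ → S) (p : ι × κ) => v p.1 p.2) ⁻¹' Set.univ.pi s =
        Set.univ.pi fun i => Set.univ.pi fun j => s (i, j) := by
      ext v; simp [Set.mem_pi]
    rw [this, Measure.pi_pi]
    simp_rw [Measure.pi_pi]
    rw [Fintype.prod_prod_type]
  refine ⟨by fun_prop, ?_⟩
  rw [← h, Measure.map_map (by fun_prop) hu]
  exact Measure.map_id

lemma isProbabilityMeasure_nullLaw (hρ : Measurable (Function.uncurry ρ)) :
    IsProbabilityMeasure (nullLaw P Q ρ) :=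
  Measure.isProbabilityMeasure_map hρ.aemeasurable

/-- Simulated observations computed from different data points are i.i.d. -/
lemma patternLaw_of_injective {ι : Type*} [Fintype ι] (hρ : Measurable (Function.uncurry ρ))
    {J : Fin m → Fin k → ι} (hJ : (Function.uncurry J).Injective) :
    patternLaw P Q ρ J = Measure.pi fun _ : Fin m => nullLaw P Q ρ := by
  have := isProbabilityMeasure_nullLaw (P := P) (Q := Q) hρ
  -- An injective `J` is a relabelling of the pattern `Prod.mk`, in which each observation owns a
  -- separate block of `k` data points; currying then exhibits the independence of the blocks.
  have h1 := patternLaw_comp_injective (P := P) (Q := Q) (m := m) hρ hJ Prod.mk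
  have e1 : (fun (t : Fin m) (s : Fin k) => Function.uncurry J (t, s)) = J := rfl
  rw [e1] at h1
  rw [h1, patternLaw]
  have hmp := (measurePreserving_curry (P := P) (ι := Fin m) (κ := Fin k)).prod
    (MeasurePreserving.id (Measure.pi fun _ : Fin m => Q))
  have hap := (measurePreserving_arrowProdEquivProdArrow (Fin k → S) A (Fin m)
    (fun _ => Measure.pi fun _ : Fin k => P) (fun _ => Q)).symm
  have hc := hap.comp hmp
  have hρ' : Measurable fun p : (Fin k → S) × A => ρ p.1 p.2 := hρ
  have hpi := Measure.pi_map_pi (μ := fun _ : Fin m => (Measure.pi fun _ : Fin k => P).prod Q)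
    (f := fun _ p => ρ p.1 p.2) (hμ := fun _ => by
      change SigmaFinite (nullLaw P Q ρ); infer_instance) (fun _ => hρ'.aemeasurable)
  have hfin : Measurable fun (x : Fin m → (Fin k → S) × A) i => ρ (x i).1 (x i).2 :=
    measurable_pi_lambda _ fun i => hρ'.comp (measurable_pi_apply i)
  change _ = Measure.pi fun _ : Fin m => ((Measure.pi fun _ : Fin k => P).prod Q).map _
  rw [← hpi, ← hc.map_eq, Measure.map_map hfin hc.measurable]
  rfl

end PatternLaw

/-! ### Conditioning on the drawn indices; collision probabilities. -/

section Mixture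

variable {S A : Type*} [MeasurableSpace S] [MeasurableSpace A] {P : Measure S}
  [IsProbabilityMeasure P] {Q : Measure A} [IsProbabilityMeasure Q] {m k n : ℕ}
  {ρ : (Fin k → S) → A → S}

/-- The uniform law of the drawn indices. -/
def drawLaw (m k n : ℕ) : Measure (Fin m → Fin k → Fin n) :=
  Measure.pi fun _ : Fin m => uniformOn (Set.univ : Set (Fin k → Fin n))

instance [NeZero n] : IsProbabilityMeasure (uniformOn (Set.univ : Set (Fin k → Fin n))) :=
  isProbabilityMeasure_uniformOn Set.finite_univ Set.univ_nonempty

instance [NeZero n] : IsProbabilityMeasure (drawLaw m k n) := by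
  unfold drawLaw; infer_instance

/-- The law of the data and of the randomness for `m` simulated observations. -/
def resampleLaw (P : Measure S) (Q : Measure A) (m k n : ℕ) :
    Measure ((Fin n → S) × (Fin m → (Fin k → Fin n) × A)) :=
  (Measure.pi fun _ : Fin n => P).prod (Measure.pi fun _ : Fin m =>
    (uniformOn (Set.univ : Set (Fin k → Fin n))).prod Q)

/-- `m` simulated observations as a function of the data and of the randomness. -/
def resample (ρ : (Fin k → S) → A → S) (p : (Fin n → S) × (Fin m → (Fin k → Fin n) × A)) :
    Fin m → S :=
  fun t => ρ (fun s => p.1 ((p.2 t).1 s)) (p.2 t).2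

lemma measurable_resample (hρ : Measurable (Function.uncurry ρ)) :
    Measurable (resample (m := m) (n := n) ρ) := by
  refine measurable_pi_lambda _ fun t => ?_
  -- The index vector takes countably many values, so measurability can be checked with it held
  -- fixed.
  have h1 : Measurable fun q : ((Fin n → S) × A) × (Fin k → Fin n) =>
      ρ (fun s => q.1.1 (q.2 s)) q.1.2 :=
    measurable_from_prod_countable_left fun J => hρ.comp
      (f := fun q : (Fin n → S) × A => ((fun s => q.1 (J s)), q.2)) (by fun_prop)
  exact h1.comp (f := fun p : (Fin n → S) × (Fin m → (Fin k → Fin n) × A) =>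
    ((p.1, (p.2 t).2), (p.2 t).1)) (by fun_prop)

/-- The factors are rearranged so that the drawn indices come first and Fubini can condition on
them. -/
lemma measurePreserving_draw [NeZero n] :
    MeasurePreserving (fun (q : (Fin m → Fin k → Fin n) × ((Fin n → S) × (Fin m → A))) =>
        (q.2.1, fun t => (q.1 t, q.2.2 t)))
      ((drawLaw m k n).prod ((Measure.pi fun _ : Fin n => P).prod (Measure.pi fun _ : Fin m => Q)))
      (resampleLaw P Q m k n) := by
  have h1 := (measurePreserving_arrowProdEquivProdArrow (Fin k → Fin n) A (Fin m)
    (fun _ => uniformOn (Set.univ : Set (Fin k → Fin n))) (fun _ => Q)).symm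
  have h2 := (MeasurePreserving.id (Measure.pi fun _ : Fin n => P)).prod h1
  have h3 := measurePreserving_prodAssoc (Measure.pi fun _ : Fin n => P) (drawLaw m k n)
    (Measure.pi fun _ : Fin m => Q)
  have h4 := (Measure.measurePreserving_swap (μ := drawLaw m k n)
    (ν := Measure.pi fun _ : Fin n => P)).prod (MeasurePreserving.id (Measure.pi fun _ : Fin m => Q))
  have h5 := (measurePreserving_prodAssoc (drawLaw m k n) (Measure.pi fun _ : Fin n => P)
    (Measure.pi fun _ : Fin m => Q)).symm
  exact h2.comp (h3.comp (h4.comp h5))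

lemma lintegral_resample [NeZero n] (hρ : Measurable (Function.uncurry ρ))
    {F : (Fin m → S) → ℝ≥0∞} (hF : Measurable F) :
    ∫⁻ p, F (resample ρ p) ∂(resampleLaw P Q m k n) =
      ∫⁻ J, ∫⁻ v, F v ∂(patternLaw P Q ρ J) ∂(drawLaw m k n) := by
  have hd := measurePreserving_draw (P := P) (Q := Q) (m := m) (k := k) (n := n)
  have hm : Measurable fun p => F (resample (m := m) (n := n) ρ p) :=
    hF.comp (measurable_resample hρ)
  have hm' := hm.comp hd.measurable
  rw [Function.comp_def] at hm'
  rw [← hd.lintegral_comp hm, lintegral_prod _ hm'.aemeasurable]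
  refine lintegral_congr fun J => ?_
  rw [patternLaw, lintegral_map hF (measurable_pattern hρ J)]
  rfl

lemma integral_resample [NeZero n] (hρ : Measurable (Function.uncurry ρ))
    {F : (Fin m → S) → ℝ} (hF : Measurable F)
    (hint : Integrable (fun p => F (resample ρ p)) (resampleLaw P Q m k n)) :
    ∫ p, F (resample ρ p) ∂(resampleLaw P Q m k n) =
      ∫ J, ∫ v, F v ∂(patternLaw P Q ρ J) ∂(drawLaw m k n) := by
  have hd := measurePreserving_draw (P := P) (Q := Q) (m := m) (k := k) (n := n)
  have hint' := hd.integrable_comp_of_integrable hint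
  rw [Function.comp_def] at hint'
  rw [← hd.map_eq, integral_map hd.measurable.aemeasurable
    (by rw [hd.map_eq]; exact hint.aestronglyMeasurable), integral_prod _ hint']
  refine integral_congr_ae (ae_of_all _ fun J => ?_)
  dsimp only
  rw [patternLaw, integral_map (measurable_pattern hρ J).aemeasurable hF.aestronglyMeasurable]
  rfl

/-- The proportion of maps from a `d`-point set to an `n`-point set that are not injective. -/
def collisionRate (n d : ℕ) : ℝ := 1 - (n.descFactorial d : ℝ) / (n : ℝ) ^ d

lemma tendsto_collisionRate (d : ℕ) : Tendsto (fun n => collisionRate n d) atTop (𝓝 0) := by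
  have h := (isEquivalent_descFactorial d)
  rw [Asymptotics.isEquivalent_iff_tendsto_one] at h
  · simpa [collisionRate] using h.const_sub 1
  · filter_upwards [eventually_gt_atTop 0] with n hn
    positivity

lemma card_not_injective [NeZero n] {α : Type*} [Fintype α] [DecidableEq α] :
    ((Finset.univ.filter fun f : α → Fin n => ¬ f.Injective).card : ℝ) =
      (n : ℝ) ^ Fintype.card α * collisionRate n (Fintype.card α) := by
  have h1 : (Finset.univ.filter fun f : α → Fin n => f.Injective).card =
      n.descFactorial (Fintype.card α) := by
    rw [← Fintype.card_subtype, Fintype.card_congr (Equiv.subtypeInjectiveEquivEmbedding α (Fin n)),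
      Fintype.card_embedding_eq, Fintype.card_fin]
  have h2 := Finset.card_filter_add_card_filter_not (s := Finset.univ)
    (fun f : α → Fin n => f.Injective)
  rw [h1, Finset.card_univ, Fintype.card_fun, Fintype.card_fin] at h2
  have h3 : ((n.descFactorial (Fintype.card α) : ℕ) : ℝ) +
      ((Finset.univ.filter fun f : α → Fin n => ¬ f.Injective).card : ℝ) =
      (n : ℝ) ^ Fintype.card α := by exact_mod_cast h2
  have hn : (n : ℝ) ≠ 0 := by exact_mod_cast NeZero.ne n
  rw [collisionRate, mul_sub, mul_one, mul_div_cancel₀ _ (pow_ne_zero _ hn)]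
  linarith

/-- The `m` independent uniform draws of `k` indices form one uniform draw of `m * k` indices, so
the probability is a ratio of cardinalities. -/
lemma drawLaw_real_not_injective [NeZero n] :
    (drawLaw m k n).real {J | ¬ (Function.uncurry J).Injective} = collisionRate n (m * k) := by
  classical
  have hn : (n : ℝ) ≠ 0 := by exact_mod_cast NeZero.ne n
  have hU : drawLaw m k n = uniformOn Set.univ := by
    rw [drawLaw, ← uniformOn_pi, Set.pi_univ]
  have hc : (Finset.univ.filter fun J : Fin m → Fin k → Fin n =>
      ¬ (Function.uncurry J).Injective).card =
      (Finset.univ.filter fun f : Fin m × Fin k → Fin n => ¬ f.Injective).card := by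
    refine Finset.card_equiv (Equiv.curry _ _ _).symm fun J => ?_
    simp
  rw [Measure.real, hU, uniformOn_univ]
  have hs : ({J | ¬ (Function.uncurry J).Injective} : Set (Fin m → Fin k → Fin n)) =
      ↑(Finset.univ.filter fun J : Fin m → Fin k → Fin n => ¬ (Function.uncurry J).Injective) := by
    ext; simp
  rw [hs, Measure.count_apply_finset, hc, ENNReal.toReal_div]
  simp only [ENNReal.toReal_natCast]
  rw [card_not_injective]
  simp only [Fintype.card_fun, Fintype.card_prod, Fintype.card_fin]
  push_cast
  rw [← pow_mul, mul_comm k m, mul_div_cancel_left₀ _ (pow_ne_zero _ hn)]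

end Mixture

/-! ### Moment bounds for `U`-statistics of simulated observations. -/

section WeakLaw

variable {S A : Type*} [MeasurableSpace S] [MeasurableSpace A] {P : Measure S}
  [IsProbabilityMeasure P] {Q : Measure A} [IsProbabilityMeasure Q] {m k n : ℕ}
  {ρ : (Fin k → S) → A → S}

instance [NeZero n] : IsProbabilityMeasure (resampleLaw P Q m k n) := by
  unfold resampleLaw; infer_instance

lemma measurePreserving_resampleLaw [NeZero n] {l : ℕ} {e : Fin l → Fin m} (he : e.Injective) :
    MeasurePreserving
      (fun p : (Fin n → S) × (Fin m → (Fin k → Fin n) × A) => (p.1, fun t => p.2 (e t)))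
      (resampleLaw P Q m k n) (resampleLaw P Q l k n) :=
  (MeasurePreserving.id _).prod (measurePreserving_precomp _ he)

/-- The sum of the first absolute moments of a kernel at two simulated observations over all
patterns of coincidences. -/
def patternNorm (P : Measure S) (Q : Measure A) (ρ : (Fin k → S) → A → S) (τ : S → S → ℝ) : ℝ≥0∞ :=
  ∑ I : Fin 2 → Fin k → Fin (2 * k), ∫⁻ v, ‖τ (v 0) (v 1)‖ₑ ∂(patternLaw P Q ρ I)

omit [IsProbabilityMeasure P] [IsProbabilityMeasure Q] in
lemma lintegral_le_patternNorm (τ : S → S → ℝ) (I : Fin 2 → Fin k → Fin (2 * k)) :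
    ∫⁻ v, ‖τ (v 0) (v 1)‖ₑ ∂(patternLaw P Q ρ I) ≤ patternNorm P Q ρ τ :=
  Finset.single_le_sum
    (f := fun I : Fin 2 → Fin k → Fin (2 * k) => ∫⁻ v, ‖τ (v 0) (v 1)‖ₑ ∂(patternLaw P Q ρ I))
    (fun _ _ => zero_le) (Finset.mem_univ I)

lemma measurable_enorm_eval {τ : S → S → ℝ} (hτ : Measurable (Function.uncurry τ)) (i j : Fin m) :
    Measurable fun v : Fin m → S => ‖τ (v i) (v j)‖ₑ :=
  (hτ.comp (f := fun v : Fin m → S => (v i, v j)) (by fun_prop)).enorm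

/-- Conditionally on the indices, the law is that of a pattern on `2k` points. The bound is
therefore free of `n`, as the truncation argument requires. -/
lemma lintegral_resample_pair_le [NeZero n] (hρ : Measurable (Function.uncurry ρ))
    {τ : S → S → ℝ} (hτ : Measurable (Function.uncurry τ)) {i j : Fin m} (hij : i ≠ j) :
    ∫⁻ p, ‖τ (resample ρ p i) (resample ρ p j)‖ₑ ∂(resampleLaw P Q m k n) ≤
      patternNorm P Q ρ τ := by
  have he : (![i, j] : Fin 2 → Fin m).Injective := by
    intro a b; fin_cases a <;> fin_cases b <;> simp [hij, hij.symm]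
  have hF := measurable_enorm_eval hτ (0 : Fin 2) 1
  have h1 := (measurePreserving_resampleLaw (P := P) (Q := Q) (k := k) (n := n) he).lintegral_comp
    (hF.comp (measurable_resample hρ))
  have h2 : ∫⁻ p, ‖τ (resample ρ p i) (resample ρ p j)‖ₑ ∂(resampleLaw P Q m k n) =
      ∫⁻ p, ‖τ (resample ρ p 0) (resample ρ p 1)‖ₑ ∂(resampleLaw P Q 2 k n) := h1
  rw [h2, lintegral_resample hρ hF]
  calc ∫⁻ J, ∫⁻ v, ‖τ (v 0) (v 1)‖ₑ ∂(patternLaw P Q ρ J) ∂(drawLaw 2 k n)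
      ≤ ∫⁻ _, patternNorm P Q ρ τ ∂(drawLaw 2 k n) := by
        refine lintegral_mono fun J => ?_
        obtain ⟨I, hI⟩ := exists_patternLaw_eq (P := P) (Q := Q) hρ J
        rw [hI]
        exact lintegral_le_patternNorm τ I
    _ = patternNorm P Q ρ τ := by simp

lemma measurable_uStat_resample (hρ : Measurable (Function.uncurry ρ)) {τ : S → S → ℝ}
    (hτ : Measurable (Function.uncurry τ)) :
    Measurable fun p : (Fin n → S) × (Fin m → (Fin k → Fin n) × A) => uStat τ (resample ρ p) :=
  (measurable_uStat hτ).comp (measurable_resample hρ)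

lemma eLpNorm_uStat_resample_le [NeZero n] (hρ : Measurable (Function.uncurry ρ))
    {τ : S → S → ℝ} (hτ : Measurable (Function.uncurry τ)) (hn : 2 ≤ m) :
    eLpNorm (fun p => uStat τ (resample ρ p)) 1 (resampleLaw P Q m k n) ≤
      patternNorm P Q ρ τ := by
  rw [eLpNorm_one_eq_lintegral_enorm]
  simp_rw [uStat_eq_sum_pairs, enorm_mul]
  have hm : ∀ p : Fin m × Fin m, Measurable
      fun q : (Fin n → S) × (Fin m → (Fin k → Fin n) × A) =>
        ‖τ (resample ρ q p.1) (resample ρ q p.2)‖ₑ := fun p =>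
    (measurable_enorm_eval hτ p.1 p.2).comp (measurable_resample hρ)
  rw [lintegral_const_mul' _ _ enorm_ne_top]
  calc ‖((m.choose 2 : ℕ) : ℝ)⁻¹‖ₑ * ∫⁻ q, ‖∑ p ∈ pairs m, τ (resample ρ q p.1) (resample ρ q p.2)‖ₑ
        ∂(resampleLaw P Q m k n)
      ≤ ‖((m.choose 2 : ℕ) : ℝ)⁻¹‖ₑ * ∫⁻ q, ∑ p ∈ pairs m, ‖τ (resample ρ q p.1) (resample ρ q p.2)‖ₑ
        ∂(resampleLaw P Q m k n) := by
        gcongr with q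
        exact enorm_sum_le _ _
    _ = ‖((m.choose 2 : ℕ) : ℝ)⁻¹‖ₑ * ∑ p ∈ pairs m,
        ∫⁻ q, ‖τ (resample ρ q p.1) (resample ρ q p.2)‖ₑ ∂(resampleLaw P Q m k n) := by
        rw [lintegral_finsetSum _ fun p _ => hm p]
    _ ≤ ‖((m.choose 2 : ℕ) : ℝ)⁻¹‖ₑ * ∑ p ∈ pairs m, patternNorm P Q ρ τ := by
        gcongr with p hp
        exact lintegral_resample_pair_le hρ hτ (mem_pairs.1 hp).ne
    _ = patternNorm P Q ρ τ := by
        have h0 : ((m.choose 2 : ℕ) : ℝ) ≠ 0 := (choose_two_pos hn).ne'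
        have h1 : ((m.choose 2 : ℕ) : ℝ≥0∞) ≠ 0 := by
          exact_mod_cast (Nat.choose_pos hn).ne'
        rw [Finset.sum_const, card_pairs, nsmul_eq_mul, ← mul_assoc, enorm_inv h0]
        rw [show ‖((m.choose 2 : ℕ) : ℝ)‖ₑ = ((m.choose 2 : ℕ) : ℝ≥0∞) by simp,
          ENNReal.inv_mul_cancel h1 (ENNReal.natCast_ne_top _), one_mul]

/-- If the `4k` drawn indices are distinct, the four observations are i.i.d. and the mean factors
into zeros. Otherwise the product is at most `C²`, an event of probability `collisionRate n (4 *
k)`. -/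
lemma abs_integral_four_le [NeZero n] (hρ : Measurable (Function.uncurry ρ)) {ψ : S → S → ℝ}
    (hψ : Measurable (Function.uncurry ψ)) {C : ℝ} (hC : ∀ x y, |ψ x y| ≤ C)
    (h0 : ∫ p, ψ p.1 p.2 ∂((nullLaw P Q ρ).prod (nullLaw P Q ρ)) = 0)
    {e : Fin 4 → Fin m} (he : e.Injective) :
    |∫ p, ψ (resample ρ p (e 0)) (resample ρ p (e 1)) * ψ (resample ρ p (e 2)) (resample ρ p (e 3))
        ∂(resampleLaw P Q m k n)| ≤ C ^ 2 * collisionRate n (4 * k) := by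
  have := isProbabilityMeasure_nullLaw (P := P) (Q := Q) hρ
  set F : (Fin 4 → S) → ℝ := fun v => ψ (v 0) (v 1) * ψ (v 2) (v 3) with hF
  have hFm : Measurable F :=
    (hψ.comp (f := fun v : Fin 4 → S => (v 0, v 1)) (by fun_prop)).mul
      (hψ.comp (f := fun v : Fin 4 → S => (v 2, v 3)) (by fun_prop))
  have hFC : ∀ v, ‖F v‖ ≤ C ^ 2 := by
    intro v
    rw [hF, Real.norm_eq_abs, abs_mul, sq]
    exact mul_le_mul (hC _ _) (hC _ _) (abs_nonneg _) ((abs_nonneg _).trans (hC (v 0) (v 1)))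
  have hmp := measurePreserving_resampleLaw (P := P) (Q := Q) (k := k) (n := n) he
  have hGm : Measurable fun p => F (resample (n := n) ρ p) := hFm.comp (measurable_resample hρ)
  have hint : Integrable (fun p => F (resample ρ p)) (resampleLaw P Q 4 k n) :=
    Integrable.of_bound hGm.aestronglyMeasurable (C ^ 2) (ae_of_all _ fun p => hFC _)
  have h1 : ∫ p, ψ (resample ρ p (e 0)) (resample ρ p (e 1)) *
      ψ (resample ρ p (e 2)) (resample ρ p (e 3)) ∂(resampleLaw P Q m k n) =
      ∫ p, F (resample ρ p) ∂(resampleLaw P Q 4 k n) :=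
    hmp.hasLaw.integral_comp hint.1
  rw [h1, integral_resample hρ hFm hint]
  have hinj : ∀ J : Fin 4 → Fin k → Fin n, (Function.uncurry J).Injective →
      ∫ v, F v ∂(patternLaw P Q ρ J) = 0 := by
    intro J hJ
    rw [patternLaw_of_injective hρ hJ]
    have hi : iIndepFun (fun (i : Fin 4) (v : Fin 4 → S) => v i)
        (Measure.pi fun _ : Fin 4 => nullLaw P Q ρ) :=
      iIndepFun_pi (μ := fun _ : Fin 4 => nullLaw P Q ρ) (X := fun _ x => x) (by fun_prop)
    have hi4 := hi.indepFun_prodMk_prodMk (by fun_prop) 0 1 2 3 (by decide) (by decide) (by decide)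
      (by decide)
    have hi' := (hi4.comp hψ hψ).integral_fun_mul_eq_mul_integral
      ((hψ.comp (f := fun v : Fin 4 → S => (v 0, v 1)) (by fun_prop)).aestronglyMeasurable)
      ((hψ.comp (f := fun v : Fin 4 → S => (v 2, v 3)) (by fun_prop)).aestronglyMeasurable)
    have hz : ∫ v, ψ (v 0) (v 1) ∂(Measure.pi fun _ : Fin 4 => nullLaw P Q ρ) = 0 := by
      rw [integral_eval_pair (g := ψ) hψ.aestronglyMeasurable (by decide), h0]
    refine hi'.trans ?_
    refine mul_eq_zero_of_left ?_ _
    exact hz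
  have hb : ∀ J : Fin 4 → Fin k → Fin n, ‖∫ v, F v ∂(patternLaw P Q ρ J)‖ ≤
      ({J | ¬ (Function.uncurry J).Injective} : Set (Fin 4 → Fin k → Fin n)).indicator
        (fun _ => C ^ 2) J := by
    intro J
    by_cases hJ : (Function.uncurry J).Injective
    · rw [hinj J hJ, norm_zero]
      exact Set.indicator_nonneg (fun _ _ => sq_nonneg C) _
    · rw [Set.indicator_of_mem (show J ∈ {J | ¬ (Function.uncurry J).Injective} from hJ)]
      have := isProbabilityMeasure_patternLaw (P := P) (Q := Q) hρ J
      simpa using norm_integral_le_of_norm_le_const (ae_of_all (patternLaw P Q ρ J) hFC)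
  rw [← Real.norm_eq_abs]
  refine (norm_integral_le_integral_norm _).trans ?_
  refine (integral_mono Integrable.of_finite Integrable.of_finite hb).trans ?_
  rw [integral_indicator (Set.toFinite _).measurableSet, setIntegral_const,
    drawLaw_real_not_injective, smul_eq_mul, mul_comm]

lemma collisionRate_nonneg [NeZero n] (d : ℕ) : 0 ≤ collisionRate n d := by
  have h := card_not_injective (n := n) (α := Fin d)
  rw [Fintype.card_fin] at h
  have hn : (0 : ℝ) < n := by exact_mod_cast NeZero.pos n
  by_contra hlt
  have := mul_neg_of_pos_of_neg (pow_pos hn d) (not_le.1 hlt)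
  rw [← h] at this
  exact absurd this (not_lt.2 (Nat.cast_nonneg _))

lemma card_pairs_not_injective_le [NeZero n] :
    ((((pairs n) ×ˢ (pairs n)).filter fun p =>
      ¬ (![p.1.1, p.1.2, p.2.1, p.2.2] : Fin 4 → Fin n).Injective).card : ℝ) ≤
      (n : ℝ) ^ 4 * collisionRate n 4 := by
  have h := card_not_injective (n := n) (α := Fin 4)
  rw [Fintype.card_fin] at h
  rw [← h]
  have : (((pairs n) ×ˢ (pairs n)).filter fun p =>
      ¬ (![p.1.1, p.1.2, p.2.1, p.2.2] : Fin 4 → Fin n).Injective).card ≤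
      (Finset.univ.filter fun f : Fin 4 → Fin n => ¬ f.Injective).card := by
    refine Finset.card_le_card_of_injOn (fun p => ![p.1.1, p.1.2, p.2.1, p.2.2]) ?_ ?_
    · intro p hp
      simpa using (Finset.mem_filter.1 hp).2
    · rintro ⟨⟨a, b⟩, c, d⟩ _ ⟨⟨a', b'⟩, c', d'⟩ _ h
      have h0 := congrFun h 0
      have h1 := congrFun h 1
      have h2 := congrFun h 2
      have h3 := congrFun h 3
      simp at h0 h1 h2 h3
      simp [h0, h1, h2, h3]
  exact_mod_cast this

/-- There are two sources of dependence: disjoint pairs of observations whose drawn indices collide,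
and pairs sharing an observation. The latter are a vanishing proportion of all pairs of pairs. -/
lemma integral_sq_uStat_resample_le [NeZero n] (hρ : Measurable (Function.uncurry ρ))
    {ψ : S → S → ℝ} (hψ : Measurable (Function.uncurry ψ)) {C : ℝ} (hC : ∀ x y, |ψ x y| ≤ C)
    (h0 : ∫ p, ψ p.1 p.2 ∂((nullLaw P Q ρ).prod (nullLaw P Q ρ)) = 0) (hn : 2 ≤ n) :
    ∫ p, uStat ψ (resample ρ p) ^ 2 ∂(resampleLaw P Q n k n) ≤
      C ^ 2 * (collisionRate n (4 * k) +
        ((n : ℝ) ^ 2 * ((n.choose 2 : ℕ) : ℝ)⁻¹) ^ 2 * collisionRate n 4) := by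
  classical
  set N : ℝ := ((n.choose 2 : ℕ) : ℝ) with hN
  have hN0 : 0 < N := choose_two_pos hn
  set G : (Fin n × Fin n) × (Fin n × Fin n) →
      ((Fin n → S) × (Fin n → (Fin k → Fin n) × A)) → ℝ := fun pq q =>
    ψ (resample ρ q pq.1.1) (resample ρ q pq.1.2) *
      ψ (resample ρ q pq.2.1) (resample ρ q pq.2.2) with hG
  have hGC : ∀ pq q, ‖G pq q‖ ≤ C ^ 2 := by
    intro pq q
    rw [hG, Real.norm_eq_abs, abs_mul, sq]
    exact mul_le_mul (hC _ _) (hC _ _) (abs_nonneg _)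
      ((abs_nonneg _).trans (hC (resample ρ q pq.1.1) (resample ρ q pq.1.1)))
  have hGm : ∀ pq, Measurable (G pq) := fun pq =>
    ((hψ.comp (f := fun v : Fin n → S => (v pq.1.1, v pq.1.2)) (by fun_prop)).comp
      (measurable_resample hρ)).mul
      ((hψ.comp (f := fun v : Fin n → S => (v pq.2.1, v pq.2.2)) (by fun_prop)).comp
      (measurable_resample hρ))
  have hGi : ∀ pq, Integrable (G pq) (resampleLaw P Q n k n) := fun pq =>
    Integrable.of_bound (hGm pq).aestronglyMeasurable (C ^ 2) (ae_of_all _ (hGC pq))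
  have hexp : ∀ q, uStat ψ (resample ρ q) ^ 2 =
      (N⁻¹) ^ 2 * ∑ pq ∈ pairs n ×ˢ pairs n, G pq q := by
    intro q
    rw [uStat_eq_sum_pairs, mul_pow, ← hN, sq (∑ p ∈ pairs n, _), Finset.sum_mul_sum,
      Finset.sum_product]
  simp_rw [hexp]
  rw [integral_const_mul, integral_finsetSum _ fun pq _ => hGi pq]
  have hterm : ∀ pq ∈ pairs n ×ˢ pairs n, ∫ q, G pq q ∂(resampleLaw P Q n k n) ≤
      C ^ 2 * collisionRate n (4 * k) +
        if ¬ (![pq.1.1, pq.1.2, pq.2.1, pq.2.2] : Fin 4 → Fin n).Injective then C ^ 2 else 0 := by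
    intro pq _
    by_cases hinj : (![pq.1.1, pq.1.2, pq.2.1, pq.2.2] : Fin 4 → Fin n).Injective
    · rw [if_neg (not_not.2 hinj), add_zero]
      exact (le_abs_self _).trans (abs_integral_four_le hρ hψ hC h0 hinj)
    · rw [if_pos hinj]
      have h1 : ∫ q, G pq q ∂(resampleLaw P Q n k n) ≤ C ^ 2 := by
        refine (le_abs_self _).trans ?_
        simpa using norm_integral_le_of_norm_le_const (ae_of_all (resampleLaw P Q n k n) (hGC pq))
      have h2 := mul_nonneg (sq_nonneg C) (collisionRate_nonneg (n := n) (4 * k))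
      linarith
  have hsum := Finset.sum_le_sum hterm
  rw [Finset.sum_add_distrib, Finset.sum_const, Finset.card_product, card_pairs, nsmul_eq_mul,
    ← Finset.sum_filter, Finset.sum_const, nsmul_eq_mul, Nat.cast_mul, ← hN] at hsum
  have hcard := mul_le_mul_of_nonneg_right (card_pairs_not_injective_le (n := n)) (sq_nonneg C)
  calc (N⁻¹) ^ 2 * ∑ pq ∈ pairs n ×ˢ pairs n, ∫ q, G pq q ∂(resampleLaw P Q n k n)
      ≤ (N⁻¹) ^ 2 * (N * N * (C ^ 2 * collisionRate n (4 * k)) +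
          (n : ℝ) ^ 4 * collisionRate n 4 * C ^ 2) := by
        refine mul_le_mul_of_nonneg_left (hsum.trans ?_) (sq_nonneg _)
        gcongr
    _ = _ := by field_simp

end WeakLaw

/-! ### Law of large numbers for unbounded kernels by truncation. -/

section Truncation

variable {S A : Type*} [MeasurableSpace S] [MeasurableSpace A] {P : Measure S}
  [IsProbabilityMeasure P] {Q : Measure A} [IsProbabilityMeasure Q] {k n : ℕ}
  {ρ : (Fin k → S) → A → S}

/-- Among the patterns on `2k` points is the one without coincidences. Bounds over all patterns
therefore also cover two independent null observations. -/
lemma exists_patternLaw_eq_pi (hρ : Measurable (Function.uncurry ρ)) :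
    ∃ I : Fin 2 → Fin k → Fin (2 * k),
      patternLaw P Q ρ I = Measure.pi fun _ : Fin 2 => nullLaw P Q ρ :=
  ⟨fun t s => finProdFinEquiv (t, s), patternLaw_of_injective hρ finProdFinEquiv.injective⟩

lemma memLp_nullLaw_prod (hρ : Measurable (Function.uncurry ρ)) {φ : S → S → ℝ} {q : ℝ≥0∞}
    (hφ : Measurable (Function.uncurry φ))
    (hI : ∀ I : Fin 2 → Fin k → Fin (2 * k),
      MemLp (fun v : Fin 2 → S => φ (v 0) (v 1)) q (patternLaw P Q ρ I)) :
    MemLp (fun p : S × S => φ p.1 p.2) q ((nullLaw P Q ρ).prod (nullLaw P Q ρ)) := by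
  have := isProbabilityMeasure_nullLaw (P := P) (Q := Q) hρ
  obtain ⟨I, h⟩ := exists_patternLaw_eq_pi (P := P) (Q := Q) hρ
  have h1 := hI I
  rw [h] at h1
  have hmp := measurePreserving_eval_pair (nullLaw P Q ρ) (i := (0 : Fin 2)) (j := 1) (by decide)
  rw [← hmp.map_eq]
  exact (memLp_map_measure_iff (g := fun p : S × S => φ p.1 p.2) hφ.aestronglyMeasurable
    hmp.measurable.aemeasurable).2 h1

lemma enorm_integral_nullLaw_le (hρ : Measurable (Function.uncurry ρ)) {τ : S → S → ℝ}
    (hτ : Measurable (Function.uncurry τ)) :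
    ‖∫ p, τ p.1 p.2 ∂((nullLaw P Q ρ).prod (nullLaw P Q ρ))‖ₑ ≤ patternNorm P Q ρ τ := by
  have := isProbabilityMeasure_nullLaw (P := P) (Q := Q) hρ
  obtain ⟨I, h⟩ := exists_patternLaw_eq_pi (P := P) (Q := Q) hρ
  refine (enorm_integral_le_lintegral_enorm _).trans ?_
  have hmp := measurePreserving_eval_pair (nullLaw P Q ρ) (i := (0 : Fin 2)) (j := 1) (by decide)
  have hm : Measurable fun p : S × S => ‖τ p.1 p.2‖ₑ := hτ.enorm
  rw [← hmp.lintegral_comp hm, ← h]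
  exact lintegral_le_patternNorm τ I

/-- The kernel `φ`, set to zero where it exceeds `M` in absolute value. -/
def trunc (φ : S → S → ℝ) (M : ℕ) (x y : S) : ℝ := if |φ x y| ≤ M then φ x y else 0

lemma measurable_trunc {φ : S → S → ℝ} (hφ : Measurable (Function.uncurry φ)) (M : ℕ) :
    Measurable (Function.uncurry (trunc φ M)) :=
  Measurable.ite (measurableSet_le hφ.abs measurable_const) hφ measurable_const

omit [MeasurableSpace S] in
lemma abs_trunc_le (φ : S → S → ℝ) (M : ℕ) (x y : S) : |trunc φ M x y| ≤ M := by
  rw [trunc]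
  split_ifs with h
  · exact h
  · simp

omit [IsProbabilityMeasure P] [IsProbabilityMeasure Q] in
lemma tendsto_patternNorm_sub_trunc {φ : S → S → ℝ} (hφ : Measurable (Function.uncurry φ))
    (hI : ∀ I : Fin 2 → Fin k → Fin (2 * k),
      Integrable (fun v : Fin 2 → S => φ (v 0) (v 1)) (patternLaw P Q ρ I)) :
    Tendsto (fun M => patternNorm P Q ρ fun x y => φ x y - trunc φ M x y) atTop (𝓝 0) := by
  have h : ∀ I ∈ (Finset.univ : Finset (Fin 2 → Fin k → Fin (2 * k))), Tendsto (fun M : ℕ =>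
      ∫⁻ v, ‖φ (v 0) (v 1) - trunc φ M (v 0) (v 1)‖ₑ ∂(patternLaw P Q ρ I)) atTop (𝓝 0) := by
    intro I _
    have h1 := tendsto_lintegral_of_dominated_convergence (μ := patternLaw P Q ρ I)
      (F := fun (M : ℕ) (v : Fin 2 → S) => ‖φ (v 0) (v 1) - trunc φ M (v 0) (v 1)‖ₑ)
      (f := fun _ => 0) (fun v => ‖φ (v 0) (v 1)‖ₑ)
      (fun M => measurable_enorm_eval (τ := fun x y => φ x y - trunc φ M x y)
        (hφ.sub (measurable_trunc hφ M)) 0 1)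
      (fun M => ae_of_all _ fun v => by
        dsimp only; unfold trunc; split_ifs <;> simp) (hI I).2.ne
      (ae_of_all _ fun v => by
        refine tendsto_const_nhds.congr' ?_
        filter_upwards [eventually_ge_atTop ⌈|φ (v 0) (v 1)|⌉₊] with M hM
        rw [trunc, if_pos ((Nat.le_ceil _).trans (by exact_mod_cast hM))]
        simp)
    simpa using h1
  simpa [patternNorm] using tendsto_finsetSum _ h

omit [MeasurableSpace S] in
lemma uStat_sub (f g : S → S → ℝ) (v : Fin n → S) :
    uStat (fun x y => f x y - g x y) v = uStat f v - uStat g v := by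
  simp only [uStat_eq_sum_pairs, Finset.sum_sub_distrib, mul_sub]

omit [MeasurableSpace S] in
lemma uStat_const (hn : 2 ≤ n) (θ : ℝ) (v : Fin n → S) : uStat (fun _ _ => θ) v = θ := by
  rw [uStat_eq_sum_pairs, Finset.sum_const, card_pairs, nsmul_eq_mul,
    inv_mul_cancel_left₀ (choose_two_pos hn).ne']

/-- The law of large numbers for `U`-statistics of simulated observations. -/
theorem tendsto_eLpNorm_uStat_resample (hρ : Measurable (Function.uncurry ρ)) {φ : S → S → ℝ}
    (hφ : Measurable (Function.uncurry φ))
    (hI : ∀ I : Fin 2 → Fin k → Fin (2 * k),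
      Integrable (fun v : Fin 2 → S => φ (v 0) (v 1)) (patternLaw P Q ρ I)) :
    Tendsto (fun n : ℕ => eLpNorm (fun p => uStat φ (resample ρ p) -
        ∫ p, φ p.1 p.2 ∂((nullLaw P Q ρ).prod (nullLaw P Q ρ))) 1 (resampleLaw P Q n k n))
      atTop (𝓝 0) := by
  have hpr := isProbabilityMeasure_nullLaw (P := P) (Q := Q) hρ
  set ν := (nullLaw P Q ρ).prod (nullLaw P Q ρ) with hν
  have hφi : Integrable (fun p : S × S => φ p.1 p.2) ν :=
    memLp_one_iff_integrable.1
      (memLp_nullLaw_prod hρ hφ fun I => memLp_one_iff_integrable.2 (hI I))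
  rw [ENNReal.tendsto_nhds_zero]
  intro ε hε
  -- Three errors are each kept below `ε / 4`: the centred truncated kernel, the truncated-away
  -- part, and the shift of the mean. The level `M` is fixed first, uniformly in `n`; only the first
  -- error then needs `n` large.
  have hε4 : 0 < ε / 4 := ENNReal.div_pos hε.ne' (by simp)
  obtain ⟨M, hM⟩ := ((ENNReal.tendsto_nhds_zero.1 (tendsto_patternNorm_sub_trunc hφ hI))
    (ε / 4) hε4).exists
  have htm := measurable_trunc hφ M
  have hti : Integrable (fun p : S × S => trunc φ M p.1 p.2) ν :=
    Integrable.of_bound htm.aestronglyMeasurable M (ae_of_all _ fun p => abs_trunc_le φ M _ _)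
  set θ := ∫ p, φ p.1 p.2 ∂ν with hθ
  set θM := ∫ p, trunc φ M p.1 p.2 ∂ν with hθM
  set τ : S → S → ℝ := fun x y => φ x y - trunc φ M x y with hτ
  set ψ : S → S → ℝ := fun x y => trunc φ M x y - θM with hψ
  have hτm : Measurable (Function.uncurry τ) := hφ.sub htm
  have hψm : Measurable (Function.uncurry ψ) := htm.sub_const _
  have hθτ : ‖θM - θ‖ₑ ≤ ε / 4 := by
    have h1 : θ - θM = ∫ p, τ p.1 p.2 ∂ν := (integral_sub hφi hti).symm
    rw [← enorm_neg, neg_sub, h1]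
    exact (enorm_integral_nullLaw_le hρ hτm).trans hM
  have hψC : ∀ x y, |ψ x y| ≤ M + |θM| := fun x y =>
    (abs_sub _ _).trans (add_le_add (abs_trunc_le φ M x y) le_rfl)
  have hψ0 : ∫ p, ψ p.1 p.2 ∂ν = 0 := by
    simp only [hψ]
    rw [integral_sub hti (integrable_const _), ← hθM]
    simp
  have hbound : Tendsto (fun n : ℕ => ENNReal.ofReal √((M + |θM|) ^ 2 * (collisionRate n (4 * k) +
      ((n : ℝ) ^ 2 * ((n.choose 2 : ℕ) : ℝ)⁻¹) ^ 2 * collisionRate n 4))) atTop (𝓝 0) := by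
    have h1 := ((tendsto_collisionRate (4 * k)).add
      ((tendsto_sq_mul_inv_choose_two.pow 2).mul (tendsto_collisionRate 4))).const_mul
      ((M + |θM|) ^ 2)
    simp only [mul_zero, add_zero] at h1
    simpa using ENNReal.tendsto_ofReal ((Real.continuous_sqrt.tendsto 0).comp h1)
  filter_upwards [ENNReal.tendsto_nhds_zero.1 hbound (ε / 4) hε4, eventually_ge_atTop 2]
    with n hn hn2
  have : NeZero n := ⟨by omega⟩
  have hψmeas := measurable_uStat_resample (m := n) (n := n) hρ hψm
  have hτmeas := measurable_uStat_resample (m := n) (n := n) hρ hτm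
  have hψmem : MemLp (fun p => uStat ψ (resample ρ p)) 2 (resampleLaw P Q n k n) := by
    simp_rw [uStat_eq_sum_pairs]
    have : MemLp (fun p => ∑ q ∈ pairs n, ψ (resample ρ p q.1) (resample ρ p q.2)) 2
        (resampleLaw P Q n k n) := by
      refine memLp_finsetSum _ fun q _ => MemLp.of_bound ?_ (M + |θM|)
        (ae_of_all _ fun p => hψC _ _)
      exact ((hψm.comp (f := fun v : Fin n → S => (v q.1, v q.2)) (by fun_prop)).comp
        (measurable_resample hρ)).aestronglyMeasurable
    exact this.const_mul _
  have hψ2 : eLpNorm (fun p => uStat ψ (resample ρ p)) 1 (resampleLaw P Q n k n) ≤ ε / 4 := by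
    refine (eLpNorm_le_eLpNorm_of_exponent_le one_le_two hψmem.1).trans ?_
    rw [eLpNorm_two_eq_ofReal_sqrt hψmem]
    refine le_trans (ENNReal.ofReal_le_ofReal (Real.sqrt_le_sqrt ?_)) hn
    exact integral_sq_uStat_resample_le hρ hψm hψC hψ0 hn2
  have hτ1 := (eLpNorm_uStat_resample_le (P := P) (Q := Q) (n := n) hρ hτm hn2).trans hM
  have hdec : (fun p : (Fin n → S) × (Fin n → (Fin k → Fin n) × A) =>
      uStat φ (resample ρ p) - θ) = ((fun p => uStat ψ (resample ρ p)) +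
        fun p => uStat τ (resample ρ p)) + fun _ => θM - θ := by
    ext p
    simp only [Pi.add_apply, hψ, hτ]
    rw [uStat_sub, uStat_sub, uStat_const hn2]
    ring
  rw [hdec]
  calc _ ≤ _ := eLpNorm_add_le (hψmeas.add hτmeas).aestronglyMeasurable
        aestronglyMeasurable_const le_rfl
    _ ≤ (ε / 4 + ε / 4) + ε / 4 := by
        refine add_le_add ((eLpNorm_add_le hψmeas.aestronglyMeasurable
          hτmeas.aestronglyMeasurable le_rfl).trans (add_le_add hψ2 hτ1)) ?_
        rw [eLpNorm_const _ one_ne_zero (NeZero.ne _)]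
        simpa using hθτ
    _ ≤ (ε / 4 + ε / 4) + (ε / 4 + ε / 4) := by gcongr; exact le_self_add
    _ = ε := by
        rw [← two_mul, ← two_mul, ← mul_assoc]
        norm_num
        exact ENNReal.mul_div_cancel (by simp) (by simp)

end Truncation

/-! ### Transfer to the given probability space. -/

section Simulated

variable {Ω S A : Type*} [MeasurableSpace Ω] [MeasurableSpace S] [MeasurableSpace A]
  {μ : Measure Ω} [IsProbabilityMeasure μ] {P : Measure S}
  [IsProbabilityMeasure P] {Q : Measure A} [IsProbabilityMeasure Q] {k n : ℕ}
  {ρ : (Fin k → S) → A → S}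

omit [IsProbabilityMeasure μ] [IsProbabilityMeasure P] in
lemma IsSample.hasLaw {w : Fin n → Ω → S} (hw : IsSample μ P w) :
    HasLaw (fun ω i => w i ω) (Measure.pi fun _ => P) μ :=
  hw.indep.hasLaw_pi hw.law

omit [IsProbabilityMeasure P] [IsProbabilityMeasure Q] in
lemma IsResampling.hasLaw {w : Fin n → Ω → S} {r : Fin n → Ω → (Fin k → Fin n) × A}
    (hw : IsSample μ P w) (hr : IsResampling μ Q w r) :
    HasLaw (fun ω => ((fun i => w i ω), fun i => r i ω)) (resampleLaw P Q n k n) μ :=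
  (indepFun_iff_hasLaw_prodMk_prod hw.hasLaw hr.sample.hasLaw).1 hr.indep_data

omit [IsProbabilityMeasure μ] in
lemma tendstoInMeasure_uStat_nullSample {W : (n : ℕ) → Fin n → Ω → S}
    {R : (n : ℕ) → Fin n → Ω → (Fin k → Fin n) × A}
    (hWR : ∀ n, HasLaw (fun ω => ((fun i => W n i ω), fun i => R n i ω)) (resampleLaw P Q n k n) μ)
    (hρ : Measurable (Function.uncurry ρ)) {φ : S → S → ℝ}
    (hφ : Measurable (Function.uncurry φ))
    (hI : ∀ I : Fin 2 → Fin k → Fin (2 * k),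
      Integrable (fun v : Fin 2 → S => φ (v 0) (v 1)) (patternLaw P Q ρ I)) :
    TendstoInMeasure μ
      (fun n ω => uStat φ (nullSample ρ (fun i => W n i ω) fun i => R n i ω)) atTop
      fun _ => ∫ p, φ p.1 p.2 ∂((nullLaw P Q ρ).prod (nullLaw P Q ρ)) := by
  have hm : ∀ n : ℕ, Measurable fun p : (Fin n → S) × (Fin n → (Fin k → Fin n) × A) =>
      uStat φ (resample ρ p) := fun n => measurable_uStat_resample hρ hφ
  refine tendstoInMeasure_of_tendsto_eLpNorm one_ne_zero
    (fun n => ((hm n).comp_aemeasurable (hWR n).aemeasurable).aestronglyMeasurable)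
    aestronglyMeasurable_const ?_
  refine (tendsto_eLpNorm_uStat_resample (P := P) (Q := Q) hρ hφ hI).congr fun n => ?_
  have hl := hWR n
  rw [← hl.map_eq, eLpNorm_map_measure ((hm n).sub_const _).aestronglyMeasurable hl.aemeasurable]
  rfl

lemma NullSquareIntegrable.memLp_patternLaw {g : S → S → ℝ} (hρ : Measurable (Function.uncurry ρ))
    (hg : Measurable (Function.uncurry g)) (h : NullSquareIntegrable P Q ρ g)
    (I : Fin 2 → Fin k → Fin (2 * k)) :
    MemLp (fun v : Fin 2 → S => g (v 0) (v 1)) 2 (patternLaw P Q ρ I) := by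
  rw [patternLaw, memLp_map_measure_iff _ (measurable_pattern hρ I).aemeasurable]
  · exact (h (I 0) (I 1)).comp_measurePreserving
      ((MeasurePreserving.id (Measure.pi fun _ : Fin (2 * k) => P)).prod
        (measurePreserving_finTwoArrow Q))
  · exact (hg.comp (f := fun v : Fin 2 → S => (v 0, v 1)) (by fun_prop)).aestronglyMeasurable

end Simulated

/-! ### Scalar projections of the Gaussian limit. -/

section Slutsky

lemma dotProduct_mulVec_comm_of_isSymm {c : ℕ} {B : Matrix (Fin c) (Fin c) ℝ} (hB : Bᵀ = B)
    (x y : Fin c → ℝ) : x ⬝ᵥ (B *ᵥ y) = y ⬝ᵥ (B *ᵥ x) := by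
  rw [Matrix.dotProduct_mulVec, dotProduct_comm, ← Matrix.mulVec_transpose, hB]

/-- The characteristic function of the projection at `t` is that of the vector at `t • y`, which is
quadratic in `t`. -/
lemma hasLaw_inner_multivariateGaussian {c : ℕ} {C : Matrix (Fin c) (Fin c) ℝ}
    (hC : C.PosSemidef) (y : EuclideanSpace ℝ (Fin c)) :
    HasLaw (fun z : EuclideanSpace ℝ (Fin c) => inner ℝ z y)
      (gaussianReal 0 (Real.toNNReal (y ⬝ᵥ (C *ᵥ y)))) (multivariateGaussian 0 C) where
  aemeasurable := by fun_prop
  map_eq := by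
    have hnn : 0 ≤ y ⬝ᵥ (C *ᵥ y) := by simpa using hC.dotProduct_mulVec_nonneg y
    have hm : Measurable fun z : EuclideanSpace ℝ (Fin c) => inner ℝ z y := by fun_prop
    have : IsProbabilityMeasure
        ((multivariateGaussian 0 C).map fun z : EuclideanSpace ℝ (Fin c) => inner ℝ z y) :=
      Measure.isProbabilityMeasure_map hm.aemeasurable
    refine Measure.ext_of_charFun (funext fun t => ?_)
    have h1 : charFun ((multivariateGaussian 0 C).map
        fun z : EuclideanSpace ℝ (Fin c) => inner ℝ z y) t =
        charFun (multivariateGaussian 0 C) (t • y) := by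
      rw [charFun_apply_real, charFun_apply, integral_map hm.aemeasurable (by fun_prop)]
      simp [inner_smul_right]
    rw [h1, charFun_multivariateGaussian hC, charFun_gaussianReal]
    congr 1
    have h2 : ((t • y : EuclideanSpace ℝ (Fin c)) : Fin c → ℝ) ⬝ᵥ
        (C *ᵥ ((t • y : EuclideanSpace ℝ (Fin c)) : Fin c → ℝ)) = t ^ 2 * (y ⬝ᵥ (C *ᵥ y)) := by
      simp only [WithLp.ofLp_smul, mulVec_smul, smul_dotProduct, dotProduct_smul,
        smul_eq_mul]
      ring
    rw [h2]
    simp only [inner_zero_right, Complex.ofReal_zero, zero_mul, mul_zero, zero_sub,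
      Real.coe_toNNReal _ hnn]
    push_cast
    ring

variable {Ω : Type*} [MeasurableSpace Ω] {μ : Measure Ω} [IsProbabilityMeasure μ]

lemma tendstoInDistribution_id_of_hasLaw {Ω' E ι : Type*} [MeasurableSpace Ω'] [TopologicalSpace E]
    [MeasurableSpace E] [OpensMeasurableSpace E] {X : ι → Ω → E} {l : Filter ι} {Z : Ω' → E}
    {μ' : Measure Ω'} [IsProbabilityMeasure μ'] {ν : Measure E} [IsProbabilityMeasure ν]
    (h : TendstoInDistribution X l Z (fun _ => μ) μ') (hZ : HasLaw Z ν μ') :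
    TendstoInDistribution X l id (fun _ => μ) ν where
  forall_aemeasurable := h.forall_aemeasurable
  tendsto := by
    have he : (⟨ν.map id, Measure.isProbabilityMeasure_map aemeasurable_id⟩ : ProbabilityMeasure E) =
        ⟨μ'.map Z, Measure.isProbabilityMeasure_map h.aemeasurable_limit⟩ :=
      Subtype.ext (Measure.map_id.trans hZ.map_eq.symm)
    rw [he]
    exact h.tendsto

end Slutsky

/-! ### Regularity of matrix inversion. -/

section Inverse

variable {c : ℕ}

lemma continuous_of_matrix : Continuous fun M : Fin c → Fin c → ℝ => Matrix.of M :=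
  continuous_matrix fun i j => by change Continuous fun M : Fin c → Fin c → ℝ => M i j; fun_prop

/-- This holds for singular `M` too, where both sides are `0` by convention. It yields measurability
everywhere and continuity wherever the determinant is nonzero. -/
lemma inv_mulVec_eq (M : Matrix (Fin c) (Fin c) ℝ) (x : Fin c → ℝ) :
    M⁻¹ *ᵥ x = M.det⁻¹ • (M.adjugate *ᵥ x) := by
  rw [Matrix.inv_def, Ring.inverse_eq_inv', Matrix.smul_mulVec]

lemma continuous_adjugate_mulVec (U : Fin c → ℝ) :
    Continuous fun q : (Fin c → Fin c → ℝ) × (Fin c → ℝ) =>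
      (Matrix.of q.1).adjugate *ᵥ (q.2 + U) :=
  (continuous_of_matrix.comp continuous_fst).matrix_adjugate.matrix_mulVec
    (continuous_snd.add continuous_const)

lemma continuous_det_of : Continuous fun q : (Fin c → Fin c → ℝ) × (Fin c → ℝ) =>
    (Matrix.of q.1).det :=
  (continuous_of_matrix.comp continuous_fst).matrix_det

lemma continuousAt_inv_mulVec (U : Fin c → ℝ) {q : (Fin c → Fin c → ℝ) × (Fin c → ℝ)}
    (hq : (Matrix.of q.1).det ≠ 0) :
    ContinuousAt (fun q : (Fin c → Fin c → ℝ) × (Fin c → ℝ) =>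
      WithLp.toLp 2 ((Matrix.of q.1)⁻¹ *ᵥ (q.2 + U))) q := by
  simp_rw [inv_mulVec_eq]
  exact (PiLp.continuous_toLp 2 _).continuousAt.comp
    ((continuous_det_of.continuousAt.inv₀ hq).smul (continuous_adjugate_mulVec U).continuousAt)

lemma measurable_inv_mulVec (U : Fin c → ℝ) :
    Measurable (fun q : (Fin c → Fin c → ℝ) × (Fin c → ℝ) =>
      WithLp.toLp 2 ((Matrix.of q.1)⁻¹ *ᵥ (q.2 + U))) := by
  simp_rw [inv_mulVec_eq]
  exact (PiLp.continuous_toLp 2 _).measurable.comp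
    (continuous_det_of.measurable.inv.smul (continuous_adjugate_mulVec U).measurable)

end Inverse

/-! ### Algebra of the estimator and of the aggregated statistic. -/

section SigmaHat

variable {S : Type*} {c n : ℕ} {h : Fin c → S → S → ℝ}

/-- The law of large numbers applies to the `U`-statistic of the product kernel; the prefactor tends
to `2`, the constant in `sigmaNull`. -/
lemma sigmaHat_apply (v : Fin n → S) (a b : Fin c) :
    sigmaHat h v a b = ((n : ℝ) ^ 2 * ((n.choose 2 : ℕ) : ℝ)⁻¹) *
      uStat (fun x y => h a x y * h b x y) v := by
  rw [sigmaHat, Matrix.of_apply, uStat, sq (((n.choose 2 : ℕ) : ℝ)), mul_inv]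
  ring

lemma transpose_sigmaHat (v : Fin n → S) : (sigmaHat h v)ᵀ = sigmaHat h v := by
  ext a b
  simp only [Matrix.transpose_apply, sigmaHat_apply, mul_comm (h a _ _)]

/-- A difference of quadratic forms with symmetric matrix factors as `(x - u)ᵀB(x + u)`, and
`n^(-3/2) * n² = √n`. The identity is exact, also for singular `sigmaHat`. -/
lemma aggStat_sub_eq (w v : Fin n → S) (U : Fin c → ℝ) :
    (n : ℝ) ^ (-(3 / 2) : ℝ) * (aggStat h w v - (n : ℝ) ^ 2 * (U ⬝ᵥ ((sigmaHat h v)⁻¹ *ᵥ U))) =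
      inner ℝ (WithLp.toLp 2 (√(n : ℝ) • (uVec h w - U)))
        (WithLp.toLp 2 ((sigmaHat h v)⁻¹ *ᵥ (uVec h w + U))) := by
  have hB : ((sigmaHat h v)⁻¹)ᵀ = (sigmaHat h v)⁻¹ := by
    rw [Matrix.transpose_nonsing_inv, transpose_sigmaHat]
  set B := (sigmaHat h v)⁻¹ with hBdef
  have hpow : (n : ℝ) ^ (-(3 / 2) : ℝ) * (n : ℝ) ^ 2 = √(n : ℝ) := by
    rcases Nat.eq_zero_or_pos n with rfl | hn
    · simp
    · have hn' : (0 : ℝ) < n := by exact_mod_cast hn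
      rw [← Real.rpow_natCast (n : ℝ) 2, ← Real.rpow_add hn', Real.sqrt_eq_rpow]
      norm_num
  have hin : ∀ x y : Fin c → ℝ, inner ℝ (WithLp.toLp 2 x) (WithLp.toLp 2 y) = x ⬝ᵥ y := by
    intro x y
    simp [PiLp.inner_apply, dotProduct, mul_comm]
  rw [hin, aggStat, ← hBdef, ← mul_sub, ← mul_assoc, hpow, smul_dotProduct, smul_eq_mul,
    mulVec_add, sub_dotProduct, dotProduct_add, dotProduct_add,
    dotProduct_mulVec_comm_of_isSymm hB U (uVec h w)]
  ring

end SigmaHat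

/-! ### Consistency of the estimator and the limit law of the aggregated statistic. -/

section Aggregated

variable {Ω S A : Type*} [MeasurableSpace Ω] [MeasurableSpace S] [MeasurableSpace A]
  {μ : Measure Ω} [IsProbabilityMeasure μ] {P : Measure S}
  [IsProbabilityMeasure P] {Q : Measure A} [IsProbabilityMeasure Q] {k c : ℕ}
  {ρ : (Fin k → S) → A → S} {h : Fin c → S → S → ℝ} {W : (n : ℕ) → Fin n → Ω → S}
  {R : (n : ℕ) → Fin n → Ω → (Fin k → Fin n) × A}

omit [MeasurableSpace S] [MeasurableSpace A] in
lemma nullSample_eq_resample {n : ℕ} (w : Fin n → S) (r : Fin n → (Fin k → Fin n) × A) :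
    nullSample ρ w r = resample ρ (w, r) := rfl

lemma tendstoInMeasure_sigmaHat
    (hWR : ∀ n, HasLaw (fun ω => ((fun i => W n i ω), fun i => R n i ω)) (resampleLaw P Q n k n) μ)
    (hρ : Measurable (Function.uncurry ρ)) (hm : ∀ a, Measurable (Function.uncurry (h a)))
    (hI : ∀ a, NullSquareIntegrable P Q ρ (h a)) (a b : Fin c) :
    TendstoInMeasure μ
      (fun n ω => sigmaHat h (nullSample ρ (fun i => W n i ω) fun i => R n i ω) a b) atTop
      fun _ => sigmaNull (nullLaw P Q ρ) h a b := by
  simp_rw [sigmaHat_apply]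
  have h1 : TendstoInMeasure μ
      (fun (n : ℕ) (_ : Ω) => (n : ℝ) ^ 2 * ((n.choose 2 : ℕ) : ℝ)⁻¹) atTop fun _ => 2 :=
    tendstoInMeasure_of_tendsto_ae (fun _ => aestronglyMeasurable_const)
      (ae_of_all _ fun _ => tendsto_sq_mul_inv_choose_two)
  have h2 := tendstoInMeasure_uStat_nullSample hWR hρ (φ := fun x y => h a x y * h b x y)
    ((hm a).mul (hm b)) fun I => ((hI a).memLp_patternLaw hρ (hm a) I).integrable_mul
      ((hI b).memLp_patternLaw hρ (hm b) I)
  have h3 := tendstoInMeasure_comp_of_continuousAt (G := fun q : ℝ × ℝ => q.1 * q.2)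
    (tendstoInMeasure_prodMk h1 h2) (by fun_prop)
  simp only [sigmaNull, Matrix.of_apply]
  exact h3

/-- The central limit theorem for the aggregated statistic with simulated covariance estimator. -/
theorem tendstoInDistribution_aggStat (hW : ∀ n, IsSample μ P (W n))
    (hR : ∀ n, IsResampling μ Q (W n) (R n)) (hρ : Measurable (Function.uncurry ρ))
    (hm : ∀ a, Measurable (Function.uncurry (h a))) (hs : ∀ a x y, h a x y = h a y x)
    (hL : ∀ a, MemLp (fun p : S × S => h a p.1 p.2) 2 (P.prod P))
    (hI : ∀ a, NullSquareIntegrable P Q ρ (h a)) (hpd : (sigmaNull (nullLaw P Q ρ) h).PosDef) :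
    TendstoInDistribution
      (fun (n : ℕ) ω => (n : ℝ) ^ (-(3 / 2) : ℝ) *
        (aggStat h (fun i => W n i ω) (nullSample ρ (fun i => W n i ω) (fun i => R n i ω)) -
          (n : ℝ) ^ 2 * (uPop P h ⬝ᵥ
            ((sigmaHat h (nullSample ρ (fun i => W n i ω) (fun i => R n i ω)))⁻¹ *ᵥ uPop P h))))
      atTop (id : ℝ → ℝ) (fun _ => μ)
      (gaussianReal 0 (Real.toNNReal
        (((sigmaNull (nullLaw P Q ρ) h)⁻¹ *ᵥ (uPop P h + uPop P h)) ⬝ᵥ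
          (sigmaAlt P h *ᵥ ((sigmaNull (nullLaw P Q ρ) h)⁻¹ *ᵥ (uPop P h + uPop P h)))))) := by
  have hWl := fun n => (hW n).hasLaw
  have hWR := fun n => IsResampling.hasLaw (hW n) (hR n)
  have hpsd : (sigmaAlt P h).PosSemidef :=
    gram_influence hm hL ▸ posSemidef_gram (memLp_influence hm hL)
  set U := uPop P h with hU
  set T := sigmaNull (nullLaw P Q ρ) h with hT
  have hdist := tendstoInDistribution_uVec hWl hm hs hL
  have hSig : TendstoInMeasure μ
      (fun n ω (a b : Fin c) => sigmaHat h (nullSample ρ (fun i => W n i ω) fun i => R n i ω) a b)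
      atTop fun _ a b => T a b :=
    tendstoInMeasure_pi fun a => tendstoInMeasure_pi fun b =>
      tendstoInMeasure_sigmaHat hWR hρ hm hI a b
  -- Positive definiteness of the limit places it where inversion is continuous, so a possibly
  -- singular estimator does no harm asymptotically.
  have hdet : (Matrix.of fun a b => T a b).det ≠ 0 := hpd.det_pos.ne'
  have hpair := tendstoInMeasure_prodMk hSig (tendstoInMeasure_uVec hWl hm hs hL)
  have hcont := continuousAt_inv_mulVec U (q := (fun a b => T a b, U)) hdet
  have hY := tendstoInMeasure_comp_of_continuousAt (x := ((fun a b => T a b, U) :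
    (Fin c → Fin c → ℝ) × (Fin c → ℝ))) hpair hcont
  have hYm : ∀ n : ℕ, AEMeasurable (fun ω => WithLp.toLp 2
      ((Matrix.of fun a b => sigmaHat h (nullSample ρ (fun i => W n i ω) fun i => R n i ω) a b)⁻¹ *ᵥ
        (uVec h (fun i => W n i ω) + U))) μ := by
    intro n
    have hq : Measurable fun p : (Fin n → S) × (Fin n → (Fin k → Fin n) × A) =>
        ((fun a b => sigmaHat h (resample ρ p) a b, uVec h p.1) :
          (Fin c → Fin c → ℝ) × (Fin c → ℝ)) := by
      refine Measurable.prodMk (measurable_pi_lambda _ fun a => measurable_pi_lambda _ fun b => ?_)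
        (measurable_pi_lambda _ fun a => (measurable_uStat (hm a)).comp measurable_fst)
      simp_rw [sigmaHat_apply]
      exact (measurable_uStat_resample hρ (τ := fun x y => h a x y * h b x y)
        ((hm a).mul (hm b))).const_mul _
    have hc := ((measurable_inv_mulVec U).comp hq).comp_aemeasurable (hWR n).aemeasurable
    simp only [nullSample_eq_resample]
    exact hc
  -- Slutsky: the first factor converges in law, the second in measure to the constant `T⁻¹ (U +
  -- U)`, and the inner product is continuous.
  have hfin := hdist.continuous_comp_prodMk_of_tendstoInMeasure_const
    (g := fun p : EuclideanSpace ℝ (Fin c) × EuclideanSpace ℝ (Fin c) => inner ℝ p.1 p.2)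
    (by fun_prop) hY hYm
  simp_rw [aggStat_sub_eq]
  exact tendstoInDistribution_id_of_hasLaw hfin
    (hasLaw_inner_multivariateGaussian hpsd (WithLp.toLp 2 (T⁻¹ *ᵥ (U + U))))

end Aggregated

end UAgg

end

/-! ### The limiting variance and the main theorem. -/

namespace UAgg

/-- Symmetry of `T⁻¹` moves it across the dot product, and the two factors `2` from `x + x` give the
`4`. -/
lemma dotProduct_inv_mulVec_add_self {c : ℕ} {T : Matrix (Fin c) (Fin c) ℝ} (hT : T.PosDef)
    (C : Matrix (Fin c) (Fin c) ℝ) (x : Fin c → ℝ) :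
    (T⁻¹ *ᵥ (x + x)) ⬝ᵥ (C *ᵥ (T⁻¹ *ᵥ (x + x))) = 4 * (x ⬝ᵥ ((T⁻¹ * C * T⁻¹) *ᵥ x)) := by
  have hB : (T⁻¹)ᵀ = T⁻¹ := by
    rw [Matrix.transpose_nonsing_inv]
    congr 1
    rw [← Matrix.conjTranspose_eq_transpose_of_trivial, hT.isHermitian.eq]
  rw [dotProduct_comm, dotProduct_mulVec_comm_of_isSymm hB, ← Matrix.mulVec_mulVec,
    ← Matrix.mulVec_mulVec, ← two_smul ℝ x]
  simp only [mulVec_smul, smul_dotProduct, dotProduct_smul, smul_eq_mul]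
  ring

end UAgg

theorem mainTheorem3 {Ω : Type u} {S : Type v} [MeasurableSpace Ω] [MeasurableSpace S]
    (μ : Measure Ω) [IsProbabilityMeasure μ] (P : Measure S) [IsProbabilityMeasure P]
    (W : (n : ℕ) → Fin n → Ω → S) (hW : ∀ n, UAgg.IsSample μ P (W n))
    (c : ℕ) (h : Fin c → S → S → ℝ)
    (hmeas : ∀ a, Measurable (Function.uncurry (h a)))
    (hsymm : ∀ a x y, h a x y = h a y x)
    (hL2 : ∀ a, MemLp (fun p : S × S => h a p.1 p.2) 2 (P.prod P))
    (hnondeg : ∀ a, Var[UAgg.proj P (h a); P] ≠ 0) :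
    -- `uPop` is the mean of the `U`-statistic, `sigmaAlt` the limiting covariance matrix
    (∀ n a, MemLp (fun ω => UAgg.uStat (h a) (fun i => W n i ω)) 2 μ) ∧
    (∀ n, 2 ≤ n → ∀ a, ∫ ω, UAgg.uStat (h a) (fun i => W n i ω) ∂μ = UAgg.uPop P h a) ∧
    (∀ a b, Tendsto (fun n : ℕ => cov[fun ω => √(n : ℝ) * UAgg.uStat (h a) (fun i => W n i ω),
        fun ω => √(n : ℝ) * UAgg.uStat (h b) (fun i => W n i ω); μ]) atTop
      (𝓝 (UAgg.sigmaAlt P h a b))) ∧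
    (UAgg.sigmaAlt P h).PosSemidef ∧
    -- the central limit theorem for the multivariate `U`-statistic
    TendstoInDistribution
      (fun (n : ℕ) ω => WithLp.toLp 2
        (√(n : ℝ) • (UAgg.uVec h (fun i => W n i ω) - UAgg.uPop P h)))
      atTop (id : EuclideanSpace ℝ (Fin c) → EuclideanSpace ℝ (Fin c)) (fun _ => μ)
      (multivariateGaussian 0 (UAgg.sigmaAlt P h)) ∧
    -- the limit law of the aggregated statistic, with the covariance estimator computed from a
    -- null sample simulated by resampling
    ∀ (A : Type w) [MeasurableSpace A] (Q : Measure A) [IsProbabilityMeasure Q] (k : ℕ)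
      (ρ : (Fin k → S) → A → S) (R : (n : ℕ) → Fin n → Ω → (Fin k → Fin n) × A),
      Measurable (Function.uncurry ρ) →
      (∀ n, UAgg.IsResampling μ Q (W n) (R n)) →
      (∀ a, UAgg.NullSquareIntegrable P Q ρ (h a)) →
      (∀ a, UAgg.proj (UAgg.nullLaw P Q ρ) (h a) =ᵐ[UAgg.nullLaw P Q ρ] 0) →
      (UAgg.sigmaNull (UAgg.nullLaw P Q ρ) h).PosDef →
      (∀ n a, MemLp (UAgg.uStat (n := n) (h a)) 2
        (Measure.pi fun _ : Fin n => UAgg.nullLaw P Q ρ)) ∧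
      (∀ a b, Tendsto (fun n : ℕ =>
          cov[fun v => (n : ℝ) * UAgg.uStat (h a) v, fun v => (n : ℝ) * UAgg.uStat (h b) v;
            Measure.pi fun _ : Fin n => UAgg.nullLaw P Q ρ]) atTop
        (𝓝 (UAgg.sigmaNull (UAgg.nullLaw P Q ρ) h a b))) ∧
      0 ≤ 4 * (UAgg.uPop P h ⬝ᵥ (((UAgg.sigmaNull (UAgg.nullLaw P Q ρ) h)⁻¹ * UAgg.sigmaAlt P h *
        (UAgg.sigmaNull (UAgg.nullLaw P Q ρ) h)⁻¹) *ᵥ UAgg.uPop P h)) ∧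
      TendstoInDistribution
        (fun (n : ℕ) ω => (n : ℝ) ^ (-(3 / 2) : ℝ) *
          (UAgg.aggStat h (fun i => W n i ω)
              (UAgg.nullSample ρ (fun i => W n i ω) (fun i => R n i ω)) -
            (n : ℝ) ^ 2 * (UAgg.uPop P h ⬝ᵥ
              ((UAgg.sigmaHat h
                (UAgg.nullSample ρ (fun i => W n i ω) (fun i => R n i ω)))⁻¹ *ᵥ
                  UAgg.uPop P h))))
        atTop (id : ℝ → ℝ) (fun _ => μ)
        (gaussianReal 0 (Real.toNNReal (4 * (UAgg.uPop P h ⬝ᵥ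
          (((UAgg.sigmaNull (UAgg.nullLaw P Q ρ) h)⁻¹ * UAgg.sigmaAlt P h *
            (UAgg.sigmaNull (UAgg.nullLaw P Q ρ) h)⁻¹) *ᵥ UAgg.uPop P h))))) := by
  have hWl := fun n => (hW n).hasLaw
  have hmU : ∀ (n : ℕ) a, Measurable fun v : Fin n → S => UAgg.uStat (h a) v :=
    fun n a => UAgg.measurable_uStat (hmeas a)
  refine ⟨fun n a => UAgg.memLp_comp_of_hasLaw (hWl n) (UAgg.memLp_uStat (hL2 a)),
    fun n hn a => ?_, fun a b => ?_, ?_, UAgg.tendstoInDistribution_uVec hWl hmeas hsymm hL2, ?_⟩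
  · exact ((hWl n).integral_comp (hmU n a).aestronglyMeasurable).trans
      (UAgg.integral_uStat ((hL2 a).integrable one_le_two) hn)
  · refine (UAgg.tendsto_cov_sqrt_mul_uStat hmeas hsymm hL2 a b).congr fun n => ?_
    exact ((hWl n).covariance_fun_comp ((hmU n a).const_mul _).aemeasurable
      ((hmU n b).const_mul _).aemeasurable).symm
  · exact UAgg.gram_influence hmeas hL2 ▸ UAgg.posSemidef_gram (UAgg.memLp_influence hmeas hL2)
  · intro A _ Q _ k ρ R hρ hR hI hdeg hpd
    have := UAgg.isProbabilityMeasure_nullLaw (P := P) (Q := Q) hρ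
    have hL0 : ∀ a, MemLp (fun p : S × S => h a p.1 p.2) 2
        ((UAgg.nullLaw P Q ρ).prod (UAgg.nullLaw P Q ρ)) := fun a =>
      UAgg.memLp_nullLaw_prod hρ (hmeas a) ((hI a).memLp_patternLaw hρ (hmeas a))
    have hpsd : (UAgg.sigmaAlt P h).PosSemidef :=
      UAgg.gram_influence hmeas hL2 ▸ UAgg.posSemidef_gram (UAgg.memLp_influence hmeas hL2)
    -- This identifies the variance coming from Slutsky's theorem with the stated one; nonnegativity
    -- is read off from the former.
    have hq := UAgg.dotProduct_inv_mulVec_add_self hpd (UAgg.sigmaAlt P h) (UAgg.uPop P h)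
    refine ⟨fun n a => UAgg.memLp_uStat (hL0 a), fun a b =>
      UAgg.tendsto_cov_uStat_of_degenerate (hL0 a) (hL0 b) (hsymm a) (hdeg a), ?_, ?_⟩
    · rw [← hq]
      simpa using hpsd.dotProduct_mulVec_nonneg
        ((UAgg.sigmaNull (UAgg.nullLaw P Q ρ) h)⁻¹ *ᵥ (UAgg.uPop P h + UAgg.uPop P h))
    · rw [← hq]
      exact UAgg.tendstoInDistribution_aggStat hW hR hρ hmeas hsymm hL2 hI hpd
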